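/- Let $\alpha>\frac12$ and $\nu>0$ be fixed, and set $\xi:=\dfrac{4\alpha\nu}{\pi(2\alpha-1)}$. Write $\Gamma^+(a,b)=\int_b^\infty t^{a-1}e^{-t}\,dt$, $B(a,b)=\Gamma(a)\Gamma(b)/\Gamma(a+b)$, $B^-(x;a,b)=\int_0^x u^{a-1}(1-u)^{b-1}\,du$, $U(a,b,z)=\frac{1}{\Gamma(a)}\int_0^\infty e^{-zt}t^{a-1}(1+t)^{b-a-1}\,dt$, and let $$G^{3,0}_{2,3}\!\left(\left.{a_1,a_2\atop b_1,b_2,b_3}\right|z\right)=\frac1{2\pi i}\int_{L}\frac{\Gamma(b_1-t)\Gamma(b_2-t)\Gamma(b_3-t)}{\Gamma(a_1-t)\Gamma(a_2-t)}\,z^t\,dt\qquad(z>0)$$ be Meijer's $G$-function, where $L$ is an upward vertical line $\operatorname{Re}t=\sigma$ with $\sigma<\min(b_1,b_2,b_3)$. For integers $k\ge 2$ let $\gamma(k)=\gamma_{\alpha,\nu}(k)$ (the limiting clustering function of the KPKVB hyperbolic random graph with parameters $\alpha,\nu$) be given, for $\alpha\neq1$, by $$\begin{aligned}\gamma(k)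=\frac{1}{8\alpha(\alpha-1)\Gamma^+(k-2\alpha,\xi)}\Big(&-\Gamma^+(k-2\alpha,\xi)-\frac{2\alpha(\alpha-\frac12)^2\xi^2\,\Gamma^+(k-2\alpha-2,\xi)}{\alpha-1}+8\alpha(\alpha-\tfrac12)\,\xi\,\Gamma^+(k-2\alpha-1,\xi)\\&+4\xi^{4\alpha-2}\,\Gamma^+(k-6\alpha+2,\xi)\Big(\frac{2^{-4\alpha}(3\alpha-1)}{\alpha-1}+(\alpha-\tfrac12)B^-(\tfrac12;1+2\alpha,-2+2\alpha)\Big)\\&+\xi^{k-2\alpha}\,\Gamma(2\alpha+1)\,e^{-\xi}\,U(2\alpha+1,1+k-2\alpha,\xi)\\&-\xi^{4\alpha-2}\,\Gamma(2\alpha+1)\,G^{3,0}_{2,3}\!\left(\left.{1,\;3-2\alpha\atop 3-4\alpha,\;-6\alpha+k+2,\;0}\right|\xi\right)\Big),\end{aligned}$$ and for $\alpha=1$ as the limit of this expression as $\alpha\to1$ (with $\nu$ and $k$ fixed), which exists. Then, as $k\to\infty$, $$\gamma(k)\sim\begin{cases}c_{\alpha,\nu}\,k^{-1}&\text{if }\alpha>\frac34,\\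 c_{\alpha,\nu}\,\dfrac{\log k}{k}&\text{if }\alpha=\frac34,\\ c_{\alpha,\nu}\,k^{2-4\alpha}&\text{if }\frac12<\alpha<\frac34,\end{cases}$$ where $$c_{\alpha,\nu}=\begin{cases}\dfrac{8\alpha\nu}{\pi(4\alpha-3)}&\text{if }\alpha>\frac34,\\[2mm] \dfrac{6\nu}{\pi}&\text{if }\alpha=\frac34,\\[2mm] \left(\dfrac{3\alpha-1}{2^{4\alpha+1}\alpha(\alpha-1)^2}+\dfrac{(\alpha-\frac12)\,B^-(\frac12;2\alpha+1,2\alpha-2)}{2(\alpha-1)\alpha}-\dfrac{B(2\alpha,3-4\alpha)}{4(\alpha-1)}\right)\xi^{4\alpha-2}&\text{if }\frac12<\alpha<\frac34.\end{cases}$$ -/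

import Mathlib

open Filter Topology MeasureTheory Asymptotics

noncomputable section

namespace KPKVB

/-- The parameter `ξ = 4αν / (π(2α - 1))`. -/
def xi (α ν : ℝ) : ℝ := 4 * α * ν / (Real.pi * (2 * α - 1))

/-- The upper incomplete gamma function `Γ⁺(a, b) = ∫_b^∞ t^(a-1) e^(-t) dt` (used for `b > 0`). -/
def upperGamma (a b : ℝ) : ℝ := ∫ t in Set.Ioi b, t ^ (a - 1) * Real.exp (-t)

/-- The lower incomplete beta function `B⁻(x; a, b) = ∫_0^x u^(a-1) (1-u)^(b-1) du`. -/
def lowerBeta (x a b : ℝ) : ℝ := ∫ u in (0 : ℝ)..x, u ^ (a - 1) * (1 - u) ^ (b - 1)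

/-- Tricomi's confluent hypergeometric function `U(a, b, z)` for `a, z > 0`, through its integral
representation. -/
def tricomiU (a b z : ℝ) : ℝ :=
  1 / Real.Gamma a *
    ∫ t in Set.Ioi (0 : ℝ), Real.exp (-(z * t)) * t ^ (a - 1) * (1 + t) ^ (b - a - 1)

/-- The Mellin-Barnes integrand
`Γ(b₁ - t) Γ(b₂ - t) Γ(b₃ - t) / (Γ(a₁ - t) Γ(a₂ - t)) * z^t`
of Meijer's G-function with indices `m = 3, ℓ = 0, p = 2, q = 3`. -/
def meijerIntegrand (a₁ a₂ b₁ b₂ b₃ z : ℝ) (t : ℂ) : ℂ :=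
  Complex.Gamma (b₁ - t) * Complex.Gamma (b₂ - t) * Complex.Gamma (b₃ - t) /
    (Complex.Gamma (a₁ - t) * Complex.Gamma (a₂ - t)) * (z : ℂ) ^ t

/-- Meijer's G-function with indices `m = 3, ℓ = 0, p = 2, q = 3`, upper parameters `a₁, a₂`, lower
parameters `b₁, b₂, b₃`, at `z > 0`:
`(1 / (2πi)) ∫_L Γ(b₁-t) Γ(b₂-t) Γ(b₃-t) / (Γ(a₁-t) Γ(a₂-t)) z^t dt`.
The contour `L` is the upward vertical line `Re t = min(b₁, b₂, b₃) - 1`, which has all poles of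
the numerator on its right (for `ℓ = 0` there are no others to be separated from them); on it
`dt = i ds`. As `p + q < 2 (m + ℓ)` the integral over the line converges for `z > 0`. The value is
real because the parameters are, so the real part is taken only to land in `ℝ`. -/
def meijerG (a₁ a₂ b₁ b₂ b₃ z : ℝ) : ℝ :=
  (1 / (2 * (Real.pi : ℂ)) *
    ∫ s : ℝ, meijerIntegrand a₁ a₂ b₁ b₂ b₃ z
      (((min b₁ (min b₂ b₃) - 1 : ℝ) : ℂ) + (s : ℂ) * Complex.I)).re

/-- The closed form of the limiting clustering function, for `α ≠ 1`. -/
def gammaClosed (α ν : ℝ) (k : ℕ) : ℝ :=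
  1 / (8 * α * (α - 1) * upperGamma (k - 2 * α) (xi α ν)) *
    (-upperGamma (k - 2 * α) (xi α ν)
      - 2 * (α * (α - 1 / 2) ^ 2 * xi α ν ^ 2 * upperGamma (k - 2 * α - 2) (xi α ν) / (α - 1))
      + 8 * α * (α - 1 / 2) * xi α ν * upperGamma (k - 2 * α - 1) (xi α ν)
      + 4 * xi α ν ^ (4 * α - 2) * upperGamma (k - 6 * α + 2) (xi α ν) *
          ((2 : ℝ) ^ (-4 * α) * (3 * α - 1) / (α - 1)
            + (α - 1 / 2) * lowerBeta (1 / 2) (1 + 2 * α) (-2 + 2 * α))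
      + xi α ν ^ ((k : ℝ) - 2 * α) * Real.Gamma (2 * α + 1) * Real.exp (-xi α ν) *
          tricomiU (2 * α + 1) (1 + k - 2 * α) (xi α ν)
      - xi α ν ^ (4 * α - 2) * Real.Gamma (2 * α + 1) *
          meijerG 1 (3 - 2 * α) (3 - 4 * α) (-6 * α + k + 2) 0 (xi α ν))

/-- The limiting clustering function `γ(k)`: the closed form if `α ≠ 1`, and the limit of the closed
form as the parameter `α` tends to `1` if `α = 1`. -/
def gammaFun (α ν : ℝ) (k : ℕ) : ℝ :=
  if α = 1 then limUnder (𝓝[≠] (1 : ℝ)) (fun a => gammaClosed a ν k) else gammaClosed α ν k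

/-- The constant `c_{α,ν}` (for `α > 1/2`). -/
def cConst (α ν : ℝ) : ℝ :=
  if 3 / 4 < α then 8 * α * ν / (Real.pi * (4 * α - 3))
  else if α = 3 / 4 then 6 * ν / Real.pi
  else
    ((3 * α - 1) / ((2 : ℝ) ^ (4 * α + 1) * α * (α - 1) ^ 2)
      + (α - 1 / 2) * lowerBeta (1 / 2) (2 * α + 1) (2 * α - 2) / (2 * (α - 1) * α)
      - ProbabilityTheory.beta (2 * α) (3 - 4 * α) / (4 * (α - 1))) * xi α ν ^ (4 * α - 2)

end KPKVB

end

/-!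
The closed form is a weighted average in disguise. Put `x = xi α ν`. Each incomplete gamma function,
Tricomi's function and Meijer's G-function can be written as an integral over `v > 1` against the
weight `v^(k-2α-1) e^(-xv)`, so that `γ(k)` is the mean of a *clustering profile* `φ(w)`, with
`w = 1/v ∈ (0, 1)` and `φ` independent of `k` (`gammaClosed_eq_profileMean`). For the G-function this
is Mellin inversion: on the contour, the integrand is the Mellin transform of a double integral of
elementary functions (`meijerG_eq_betaLaplace`).

At `α = 1` the formula for `φ` has a double pole, cancelled by its numerator. The singularity is
removed by a differential equation: `(w^(2-4α) φ(w))' = w^(1-4α) E(w)`, where `E` is elementary and is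
a simple difference quotient in `α` at `1`. Hence `φ` is determined by `E` and the end value `φ(1)`
(`closedProfile_eq_profile`). Both have limits as `α → 1`, the second one because the incomplete beta
function is differentiable in `α` with the value `log 2 - 5/8` at `α = 1`
(`exists_tendsto_closedProfile_one`). Dominated convergence then gives the limit of the closed form,
and shows that it is again the mean of a profile (`tendsto_gammaClosed`, `gammaFun_eq_profileMean`).

For the asymptotics, the weight concentrates at `v ≈ k / x`: lowering its exponent by `q` multiplies
the total mass by about `(x / k)^q` (`tendsto_expMoment_ratio`). So `φ(w) ~ c w^p` at `w = 0` implies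
`γ(k) ~ c (x / k)^p` (`tendsto_profileMean_mul_rpow`), and `φ(w) = w log (1/w) + O(w)` implies
`γ(k) ~ x log k / k` (`tendsto_profileMean_log`). As `E(w) ~ -(4α-2) w`, the profile behaves like
`(4α-2)/(4α-3) w` for `α > 3/4`, like `w log (1/w)` for `α = 3/4`, and like a constant times
`w^(4α-2)` for `α < 3/4`; that constant is positive, so that the equivalence is not with zero
(`cConst_pos_of_lt`).
-/

noncomputable section

namespace KPKVB

/-! ### Exponentially weighted moments on `(1, ∞)` -/

/-- The moment `∫_1^∞ v^s e^(-xv) dv`, the upper incomplete gamma function after rescaling. -/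
def expMoment (x s : ℝ) : ℝ := ∫ v in Set.Ioi (1 : ℝ), v ^ s * Real.exp (-(x * v))

lemma integrableOn_rpow_mul_exp_Ioi_one {x : ℝ} (hx : 0 < x) (s : ℝ) :
    IntegrableOn (fun v : ℝ => v ^ s * Real.exp (-(x * v))) (Set.Ioi 1) := by
  have h := (integrableOn_rpow_mul_exp_neg_mul_rpow (p := 1) (s := |s|) (b := x)
    (by linarith [abs_nonneg s]) one_pos hx).mono_set
      (Set.Ioi_subset_Ioi (zero_le_one : (0 : ℝ) ≤ 1))
  refine Integrable.mono' h ?_ ?_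
  · refine ContinuousOn.aestronglyMeasurable ?_ measurableSet_Ioi
    intro v hv
    have : v ≠ 0 := by have := Set.mem_Ioi.1 hv; positivity
    exact ((Real.continuousAt_rpow_const _ _ (Or.inl this)).mul
      (by fun_prop)).continuousWithinAt
  · refine (ae_restrict_mem measurableSet_Ioi).mono fun v hv => ?_
    have hv1 : 1 < v := hv
    have hv0 : 0 < v := by linarith
    rw [Real.norm_of_nonneg (by positivity)]
    simp only [Real.rpow_one, neg_mul]
    gcongr
    · exact hv1.le
    · exact le_abs_self s

lemma expMoment_pos {x : ℝ} (hx : 0 < x) (s : ℝ) : 0 < expMoment x s := by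
  rw [expMoment, setIntegral_pos_iff_support_of_nonneg_ae]
  · have : Set.Ioi (1 : ℝ) ⊆
        (Function.support fun v : ℝ => v ^ s * Real.exp (-(x * v))) ∩ Set.Ioi 1 := by
      intro v hv
      refine ⟨?_, hv⟩
      have : 0 < v := lt_trans one_pos hv
      simp only [Function.mem_support]
      positivity
    exact lt_of_lt_of_le (by simp) (measure_mono this)
  · refine (ae_restrict_mem measurableSet_Ioi).mono fun v hv => ?_
    have : 0 < v := lt_trans one_pos hv
    simp only [Pi.zero_apply]
    positivity
  · exact integrableOn_rpow_mul_exp_Ioi_one hx s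

lemma upperGamma_eq_expMoment {x : ℝ} (hx : 0 < x) (s : ℝ) :
    upperGamma s x = x ^ s * expMoment x (s - 1) := by
  have h := integral_comp_mul_left_Ioi (fun t : ℝ => t ^ (s - 1) * Real.exp (-t)) 1 hx
  rw [mul_one] at h
  have h2 : upperGamma s x =
      x * ∫ v in Set.Ioi (1 : ℝ), (x * v) ^ (s - 1) * Real.exp (-(x * v)) := by
    rw [h, upperGamma, smul_eq_mul, mul_inv_cancel_left₀ hx.ne']
  rw [h2, expMoment, ← integral_const_mul, ← integral_const_mul]
  refine setIntegral_congr_fun measurableSet_Ioi fun v hv => ?_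
  have : 0 < v := lt_trans one_pos hv
  rw [Real.mul_rpow hx.le this.le, Real.rpow_sub_one hx.ne']
  field_simp

lemma tendsto_Gamma_div_of_pos {c : ℝ} (hc : 0 < c) :
    Tendsto (fun k : ℕ => Real.Gamma (k + 1 + c) / (k.factorial * (k : ℝ) ^ c)) atTop (𝓝 1) := by
  have h := Real.GammaSeq_tendsto_Gamma c
  have hG := (Real.Gamma_pos_of_pos hc)
  have h2 : Tendsto (fun k : ℕ => Real.Gamma c / Real.GammaSeq c k) atTop (𝓝 1) := by
    have := (tendsto_const_nhds (x := Real.Gamma c)).div h hG.ne'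
    rwa [div_self hG.ne'] at this
  refine h2.congr fun k => ?_
  have hprod : ∀ n : ℕ, Real.Gamma (n + 1 + c) =
      Real.Gamma c * ∏ j ∈ Finset.range (n + 1), (c + j) := by
    intro n
    induction n with
    | zero => simp [add_comm (1 : ℝ) c, Real.Gamma_add_one hc.ne', mul_comm]
    | succ n ih =>
      rw [Finset.prod_range_succ, ← mul_assoc, ← ih]
      have : ((n + 1 : ℕ) : ℝ) + 1 + c = (n + 1 + c) + 1 := by push_cast; ring
      rw [this, Real.Gamma_add_one (by positivity)]
      push_cast; ring
  rw [hprod, Real.GammaSeq]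
  rw [div_div_eq_mul_div, mul_comm ((k : ℝ) ^ c)]

lemma tendsto_Gamma_div (c : ℝ) :
    Tendsto (fun k : ℕ => Real.Gamma (k + 1 + c) / (k.factorial * (k : ℝ) ^ c)) atTop (𝓝 1) := by
  obtain ⟨n, hn⟩ := exists_nat_gt (-c)
  induction n generalizing c with
  | zero => exact tendsto_Gamma_div_of_pos (by simpa using hn)
  | succ n ih =>
    have h := ih (c + 1) (by push_cast at hn; linarith)
    have h2 : Tendsto (fun k : ℕ => (k : ℝ) / (k + (1 + c))) atTop (𝓝 1) :=
      tendsto_natCast_div_add_atTop (1 + c)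
    have h3 := h.mul h2
    rw [one_mul] at h3
    refine h3.congr' ?_
    obtain ⟨N, hN⟩ := exists_nat_gt (-(1 + c))
    filter_upwards [eventually_ge_atTop N, eventually_gt_atTop 0] with k hk hk0
    have hk0' : (0 : ℝ) < k := by exact_mod_cast hk0
    have hkN : (N : ℝ) ≤ k := by exact_mod_cast hk
    have hpos : (k : ℝ) + 1 + c ≠ 0 := by linarith
    have hpos' : (k : ℝ) + (1 + c) ≠ 0 := by linarith
    have e1 : (k : ℝ) + 1 + (c + 1) = (k + 1 + c) + 1 := by ring
    rw [e1, Real.Gamma_add_one hpos, Real.rpow_add_one hk0'.ne']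
    have := (Real.rpow_pos_of_pos hk0' c).ne'
    field_simp
    ring

/-- Stirling-type asymptotics of the moments: the part of the gamma integral over `(0, 1)` is
bounded, hence negligible. -/
lemma tendsto_expMoment_div {x : ℝ} (hx : 0 < x) (c : ℝ) :
    Tendsto (fun k : ℕ => expMoment x (k + c) / (k.factorial * (k : ℝ) ^ c * x ^ (-(k + 1 + c))))
      atTop (𝓝 1) := by
  have h1 := tendsto_Gamma_div c
  have h2 : Tendsto (fun k : ℕ => x ^ k / k.factorial * (x ^ (1 + c) * (k : ℝ) ^ (-c)))
      atTop (𝓝 0) := by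
    -- `x^k / k!` beats any power of `k`, since `(2x)^k / k!` tends to zero as well
    have e1 := FloorSemiring.tendsto_pow_div_factorial_atTop (2 * x)
    have e2 : Tendsto (fun k : ℕ => (k : ℝ) ^ (-c) * Real.exp (-Real.log 2 * k)) atTop (𝓝 0) :=
      (tendsto_rpow_mul_exp_neg_mul_atTop_nhds_zero (-c) (Real.log 2)
        (Real.log_pos one_lt_two)).comp tendsto_natCast_atTop_atTop
    have e3 := (e1.mul e2).const_mul (x ^ (1 + c))
    simp only [mul_zero] at e3
    refine e3.congr fun k => ?_
    have : Real.exp (-Real.log 2 * k) = ((2 : ℝ) ^ k)⁻¹ := by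
      rw [neg_mul, Real.exp_neg, mul_comm, Real.exp_nat_mul, Real.exp_log two_pos]
    rw [this, mul_pow]
    field_simp
  obtain ⟨N, hN⟩ := exists_nat_gt (-c)
  have hev : ∀ᶠ k : ℕ in atTop, 0 < (k : ℝ) ∧ 0 < (k : ℝ) + c := by
    filter_upwards [eventually_ge_atTop N, eventually_gt_atTop 0] with k hk hk0
    have hkN : (N : ℝ) ≤ k := by exact_mod_cast hk
    exact ⟨by exact_mod_cast hk0, by linarith⟩
  have hbounds : ∀ᶠ k : ℕ in atTop,
      Real.Gamma (k + 1 + c) * x ^ (-(k + 1 + c)) - 1 ≤ expMoment x (k + c) ∧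
      expMoment x (k + c) ≤ Real.Gamma (k + 1 + c) * x ^ (-(k + 1 + c)) := by
    filter_upwards [hev] with k hk
    have hG := Real.integral_rpow_mul_exp_neg_mul_Ioi (a := k + 1 + c) (r := x) (by linarith) hx
    have hi : IntegrableOn (fun v : ℝ => v ^ ((k : ℝ) + c) * Real.exp (-(x * v))) (Set.Ioi 0) := by
      have := integrableOn_rpow_mul_exp_neg_mul_rpow (p := 1) (s := k + c) (b := x)
        (by linarith) one_pos hx
      simpa using this
    have hsplit : ∫ v in Set.Ioi (0 : ℝ), v ^ ((k : ℝ) + c) * Real.exp (-(x * v)) =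
        (∫ v in Set.Ioc (0 : ℝ) 1, v ^ ((k : ℝ) + c) * Real.exp (-(x * v))) +
          expMoment x (k + c) := by
      rw [expMoment, ← setIntegral_union (by simp) measurableSet_Ioi
        (hi.mono_set Set.Ioc_subset_Ioi_self)
        (hi.mono_set (Set.Ioi_subset_Ioi zero_le_one)), Set.Ioc_union_Ioi_eq_Ioi zero_le_one]
    have e1 : (k : ℝ) + 1 + c - 1 = k + c := by ring
    rw [e1, hsplit] at hG
    have e2 : (1 / x) ^ ((k : ℝ) + 1 + c) = x ^ (-((k : ℝ) + 1 + c)) := by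
      rw [Real.rpow_neg hx.le, one_div, Real.inv_rpow hx.le]
    rw [e2, mul_comm] at hG
    have h0 : 0 ≤ ∫ v in Set.Ioc (0 : ℝ) 1, v ^ ((k : ℝ) + c) * Real.exp (-(x * v)) := by
      refine setIntegral_nonneg measurableSet_Ioc fun v hv => ?_
      have := hv.1
      positivity
    have h1 : ∫ v in Set.Ioc (0 : ℝ) 1, v ^ ((k : ℝ) + c) * Real.exp (-(x * v)) ≤ 1 := by
      calc _ ≤ ∫ v in Set.Ioc (0 : ℝ) 1, (1 : ℝ) := by
            refine setIntegral_mono_on (hi.mono_set Set.Ioc_subset_Ioi_self)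
              (by simp) measurableSet_Ioc fun v hv => ?_
            have := hv.1
            refine mul_le_one₀ (Real.rpow_le_one hv.1.le hv.2 (by linarith)) (by positivity) ?_
            rw [Real.exp_le_one_iff]
            have : 0 ≤ x * v := by positivity
            linarith
        _ = 1 := by simp
    constructor <;> linarith
  have h3 := h1.sub h2
  rw [sub_zero] at h3
  refine tendsto_of_tendsto_of_tendsto_of_le_of_le' h3 h1 ?_ ?_
  · filter_upwards [hbounds, hev] with k hk hk0
    have hk0' := hk0.1
    rw [le_div_iff₀ (by positivity)]
    refine le_trans (le_of_eq ?_) hk.1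
    have a1 := (Real.rpow_pos_of_pos hk0' c).ne'
    have a2 : x ^ k * (x ^ (1 + c) * x ^ (-((k : ℝ) + 1 + c))) = 1 := by
      rw [← Real.rpow_natCast, ← Real.rpow_add hx, ← Real.rpow_add hx]
      ring_nf; simp
    have a3 : (k : ℝ) ^ (-c) * (k : ℝ) ^ c = 1 := by
      rw [← Real.rpow_add hk0']; simp
    have a4 : (k.factorial : ℝ) ≠ 0 := by positivity
    calc _ = Real.Gamma (k + 1 + c) * x ^ (-((k : ℝ) + 1 + c)) -
          (x ^ k * (x ^ (1 + c) * x ^ (-((k : ℝ) + 1 + c)))) * ((k : ℝ) ^ (-c) * (k : ℝ) ^ c) := by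
            field_simp
      _ = _ := by rw [a2, a3, mul_one]
  · filter_upwards [hbounds, hev] with k hk hk0
    have hk0' := hk0.1
    rw [div_le_iff₀ (by positivity)]
    refine le_trans hk.2 (le_of_eq ?_)
    have a1 := (Real.rpow_pos_of_pos hk0' c).ne'
    field_simp

/-- Lowering the exponent by `q` lowers the moment by the factor `(x / k)^q`, asymptotically: the
weight `v^k e^(-xv)` concentrates at `v ≈ k / x`. -/
lemma tendsto_expMoment_ratio {x : ℝ} (hx : 0 < x) (c q : ℝ) :
    Tendsto (fun k : ℕ => expMoment x (k + c - q) / expMoment x (k + c) * (k : ℝ) ^ q)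
      atTop (𝓝 (x ^ q)) := by
  have h := ((tendsto_expMoment_div hx (c - q)).div (tendsto_expMoment_div hx c)
    one_ne_zero).const_mul (x ^ q)
  rw [div_one, mul_one] at h
  refine h.congr' ?_
  filter_upwards [eventually_gt_atTop 0] with k hk
  have hk0 : (0 : ℝ) < k := by exact_mod_cast hk
  have e1 : (k : ℝ) ^ (c - q) * (k : ℝ) ^ q = (k : ℝ) ^ c := by
    rw [← Real.rpow_add hk0]; ring_nf
  have e2 : x ^ (-((k : ℝ) + 1 + (c - q))) = x ^ q * x ^ (-((k : ℝ) + 1 + c)) := by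
    rw [← Real.rpow_add hx]; ring_nf
  have := expMoment_pos hx (k + c)
  simp only [Pi.div_apply]
  rw [e2, ← e1, add_sub_assoc]
  field_simp

/-! ### Incomplete beta tails and their Mellin transform -/

lemma hasDerivAt_integral_to_one {f : ℝ → ℝ} (hf : ContinuousOn f (Set.Ioi 0)) {w : ℝ}
    (hw : 0 < w) : HasDerivAt (fun u => ∫ x in u..1, f x) (-f w) w := by
  refine intervalIntegral.integral_hasDerivAt_left ?_ ?_ (hf.continuousAt (Ioi_mem_nhds hw))
  · refine ContinuousOn.intervalIntegrable (hf.mono fun x hx => ?_)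
    have := (Set.mem_uIcc.1 hx)
    rcases this with h | h
    · exact lt_of_lt_of_le hw h.1
    · exact lt_of_lt_of_le one_pos h.1
  · exact hf.stronglyMeasurableAtFilter isOpen_Ioi _ hw

/-- The tail `∫_w^1 x^(b-1) (1-x)^(c-1) dx` of the beta integral; the singularity at `0` is cut off,
so `b` may be any real number. -/
def tailBeta (b c w : ℝ) : ℝ := ∫ x in w..1, x ^ (b - 1) * (1 - x) ^ (c - 1)

lemma continuousOn_betaIntegrand (b : ℝ) {c : ℝ} (hc : 1 ≤ c) :
    ContinuousOn (fun x : ℝ => x ^ (b - 1) * (1 - x) ^ (c - 1)) (Set.Ioi 0) := by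
  intro x hx
  refine ContinuousAt.continuousWithinAt ?_
  have hx' : (x : ℝ) ≠ 0 := (Set.mem_Ioi.1 hx).ne'
  refine (Real.continuousAt_rpow_const _ _ (Or.inl hx')).mul ?_
  exact (Real.continuous_rpow_const (by linarith)).continuousAt.comp (by fun_prop)

lemma hasDerivAt_tailBeta (b : ℝ) {c w : ℝ} (hc : 1 ≤ c) (hw : 0 < w) :
    HasDerivAt (tailBeta b c) (-(w ^ (b - 1) * (1 - w) ^ (c - 1))) w :=
  hasDerivAt_integral_to_one (continuousOn_betaIntegrand b hc) hw

lemma continuousOn_tailBeta (b : ℝ) {c : ℝ} (hc : 1 ≤ c) :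
    ContinuousOn (tailBeta b c) (Set.Ioi 0) := fun _ hw =>
  (hasDerivAt_tailBeta b hc hw).continuousAt.continuousWithinAt

lemma tailBeta_one (b c : ℝ) : tailBeta b c 1 = 0 := by simp [tailBeta]

lemma tailBeta_nonneg (b c : ℝ) {w : ℝ} (hw : 0 < w) (hw1 : w ≤ 1) : 0 ≤ tailBeta b c w := by
  refine intervalIntegral.integral_nonneg hw1 fun x hx => ?_
  have h1 : 0 ≤ x := hw.le.trans hx.1
  have h2 : 0 ≤ 1 - x := by linarith [hx.2]
  positivity

/-- The exponent `1/2 - σ` leaves a margin of `1/2` at the abscissa `σ`, which makes the Mellin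
integral of the tail converge there. -/
lemma tailBeta_le {b c σ w : ℝ} (hc : 1 ≤ c) (hσ : 1 ≤ σ) (hb : 1 ≤ b + σ) (hw : 0 < w)
    (hw1 : w ≤ 1) : tailBeta b c w ≤ 2 * w ^ (1 / 2 - σ) := by
  have hint : ∀ r : ℝ, IntervalIntegrable (fun x : ℝ => x ^ r) volume w 1 := fun r =>
    intervalIntegral.intervalIntegrable_rpow (Or.inr (by
      rw [Set.uIcc_of_le hw1]; exact fun h => absurd h.1 (by linarith)))
  have hsub : Set.Icc w 1 ⊆ Set.Ioi 0 := fun x hx => lt_of_lt_of_le hw hx.1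
  calc tailBeta b c w ≤ ∫ x in w..1, w ^ (1 / 2 - σ) * x ^ (-(1 / 2) : ℝ) := by
        refine intervalIntegral.integral_mono_on hw1 ?_ ((hint _).const_mul _) fun x hx => ?_
        · refine ContinuousOn.intervalIntegrable ?_
          rw [Set.uIcc_of_le hw1]
          exact (continuousOn_betaIntegrand b hc).mono hsub
        · have hx0 : 0 < x := lt_of_lt_of_le hw hx.1
          have h1 : (1 - x) ^ (c - 1) ≤ 1 :=
            Real.rpow_le_one (by linarith [hx.2]) (by linarith) (by linarith)
          have h2 : x ^ (b - 1) ≤ x ^ (-σ) :=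
            Real.rpow_le_rpow_of_exponent_ge hx0 hx.2 (by linarith)
          have h3 : x ^ (-σ) = x ^ (1 / 2 - σ) * x ^ (-(1 / 2) : ℝ) := by
            rw [← Real.rpow_add hx0]; ring_nf
          have h4 : x ^ (1 / 2 - σ) ≤ w ^ (1 / 2 - σ) :=
            Real.rpow_le_rpow_of_nonpos hw hx.1 (by linarith)
          calc x ^ (b - 1) * (1 - x) ^ (c - 1) ≤ x ^ (b - 1) * 1 := by gcongr
            _ ≤ x ^ (-σ) := by linarith
            _ ≤ _ := by rw [h3]; gcongr
    _ = w ^ (1 / 2 - σ) * (2 - 2 * w ^ (1 / 2 : ℝ)) := by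
        rw [intervalIntegral.integral_const_mul, integral_rpow (Or.inl (by norm_num))]
        norm_num
        left; ring
    _ ≤ _ := by
        have := Real.rpow_pos_of_pos hw (1 / 2 - σ)
        have := Real.rpow_pos_of_pos hw (1 / 2)
        nlinarith

/-- Mellin transform of the tail, by parts: the boundary terms vanish at both ends. -/
lemma integral_cpow_mul_tailBeta {b c : ℝ} {s : ℂ} (hc : 1 ≤ c) (hs : 1 ≤ s.re)
    (hb : 1 ≤ b + s.re) :
    IntervalIntegrable (fun w : ℝ => (w : ℂ) ^ (s - 1) * (tailBeta b c w : ℂ)) volume 0 1 ∧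
    ∫ w in (0 : ℝ)..1, (w : ℂ) ^ (s - 1) * (tailBeta b c w : ℂ) =
      1 / s * Complex.betaIntegral (s + b) c := by
  have hs0 : s ≠ 0 := by
    rintro rfl; simp at hs; linarith
  have hi1 : IntervalIntegrable (fun w : ℝ => (w : ℂ) ^ (s - 1) * (tailBeta b c w : ℂ))
      volume 0 1 := by
    have hbd : IntervalIntegrable (fun x : ℝ => 2 * x ^ (-(1 / 2) : ℝ)) volume 0 1 :=
      (intervalIntegral.intervalIntegrable_rpow' (by norm_num)).const_mul _
    refine hbd.mono_fun' ?_ ?_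
    · rw [Set.uIoc_of_le zero_le_one]
      refine ContinuousOn.aestronglyMeasurable ?_ measurableSet_Ioc
      intro w hw
      refine ContinuousAt.continuousWithinAt ?_
      refine ContinuousAt.mul ?_ ?_
      · exact (Complex.continuousAt_ofReal_cpow_const _ _ (Or.inr hw.1.ne'))
      · exact Complex.continuous_ofReal.continuousAt.comp
          ((continuousOn_tailBeta b hc).continuousAt (Ioi_mem_nhds hw.1))
    · rw [Set.uIoc_of_le zero_le_one]
      refine (ae_restrict_mem measurableSet_Ioc).mono fun w hw => ?_
      have hw0 : 0 < w := hw.1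
      beta_reduce
      rw [norm_mul, Complex.norm_cpow_eq_rpow_re_of_pos hw0, Complex.norm_real,
        Real.norm_of_nonneg (tailBeta_nonneg b c hw0 hw.2)]
      have := tailBeta_le hc hs hb hw0 hw.2
      calc w ^ (s - 1).re * tailBeta b c w
          ≤ w ^ (s - 1).re * (2 * w ^ (1 / 2 - s.re)) := by gcongr
        _ = 2 * (w ^ (s - 1).re * w ^ (1 / 2 - s.re)) := by ring
        _ = _ := by
          rw [← Real.rpow_add hw0]; simp only [Complex.sub_re, Complex.one_re]; ring_nf
  have hi2 : IntervalIntegrable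
      (fun w : ℝ => 1 / s * ((w : ℂ) ^ (s + b - 1) * (1 - (w : ℂ)) ^ ((c : ℂ) - 1))) volume 0 1 :=
    (Complex.betaIntegral_convergent (by simp; linarith) (by simp; linarith)).const_mul _
  refine ⟨hi1, ?_⟩
  have key : ∫ w in (0 : ℝ)..1, ((w : ℂ) ^ (s - 1) * (tailBeta b c w : ℂ) -
      1 / s * ((w : ℂ) ^ (s + b - 1) * (1 - (w : ℂ)) ^ ((c : ℂ) - 1))) = 0 - 0 := by
    refine intervalIntegral.integral_eq_sub_of_hasDerivAt_of_tendsto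
      (f := fun w : ℝ => (w : ℂ) ^ s / s * (tailBeta b c w : ℂ)) one_pos ?_ (hi1.sub hi2) ?_ ?_
    · intro w hw
      have h1 := hasDerivAt_ofReal_cpow_const' (x := w) hw.1.ne' (r := s - 1)
        (by intro h; apply hs0; linear_combination h)
      have h2 := (hasDerivAt_tailBeta b hc hw.1).ofReal_comp
      have h3 := h1.mul h2
      simp only [sub_add_cancel] at h3
      refine h3.congr_deriv ?_
      have e1 : (w : ℂ) ^ (s + b - 1) = (w : ℂ) ^ s * (w : ℂ) ^ ((b : ℂ) - 1) := by
        rw [← Complex.cpow_add _ _ (by exact_mod_cast hw.1.ne')]; ring_nf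
      have h1w : (0 : ℝ) ≤ 1 - w := by linarith [hw.2]
      rw [e1]
      push_cast [Complex.ofReal_cpow hw.1.le, Complex.ofReal_cpow h1w]
      ring
    · rw [tendsto_zero_iff_norm_tendsto_zero]
      have hlim : Tendsto (fun w : ℝ => 2 / ‖s‖ * w ^ (1 / 2 : ℝ)) (𝓝[>] 0) (𝓝 0) := by
        have : ContinuousAt (fun w : ℝ => 2 / ‖s‖ * w ^ (1 / 2 : ℝ)) 0 :=
          continuousAt_const.mul (Real.continuousAt_rpow_const _ _ (Or.inr (by norm_num)))
        have h := this.tendsto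
        simp only [one_div, ne_eq, inv_eq_zero, OfNat.ofNat_ne_zero, not_false_eq_true,
          Real.zero_rpow, mul_zero] at h
        simpa using h.mono_left nhdsWithin_le_nhds
      refine tendsto_of_tendsto_of_tendsto_of_le_of_le' tendsto_const_nhds hlim
        (Eventually.of_forall fun _ => norm_nonneg _) ?_
      filter_upwards [Ioo_mem_nhdsGT one_pos] with w hw
      have hw0 : 0 < w := hw.1
      rw [norm_mul, norm_div, Complex.norm_cpow_eq_rpow_re_of_pos hw0, Complex.norm_real,
        Real.norm_of_nonneg (tailBeta_nonneg b c hw0 hw.2.le)]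
      have := tailBeta_le hc hs hb hw0 hw.2.le
      calc w ^ s.re / ‖s‖ * tailBeta b c w
          ≤ w ^ s.re / ‖s‖ * (2 * w ^ (1 / 2 - s.re)) := by gcongr
        _ = 2 / ‖s‖ * (w ^ s.re * w ^ (1 / 2 - s.re)) := by ring
        _ = _ := by rw [← Real.rpow_add hw0]; ring_nf
    · have : ContinuousAt (fun w : ℝ => (w : ℂ) ^ s / s * (tailBeta b c w : ℂ)) 1 :=
        ((Complex.continuousAt_ofReal_cpow_const _ _ (Or.inr one_ne_zero)).div_const _).mul
          (Complex.continuous_ofReal.continuousAt.comp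
            (hasDerivAt_tailBeta b hc one_pos).continuousAt)
      have h := this.tendsto
      simp only [tailBeta_one, Complex.ofReal_zero, mul_zero] at h
      exact h.mono_left nhdsWithin_le_nhds
  rw [intervalIntegral.integral_sub hi1 hi2, intervalIntegral.integral_const_mul, sub_self,
    sub_eq_zero] at key
  exact key

/-! ### Meijer's G-function as a real integral -/

/-- The real-integral form of the G-function, up to the factor `1 / Γ(c)`. -/
def betaLaplace (b₁ b₂ c z : ℝ) : ℝ :=
  z ^ b₂ * ∫ v in Set.Ioi (1 : ℝ), v ^ (b₂ - 1) * Real.exp (-(z * v)) * tailBeta b₁ c v⁻¹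

lemma tailBeta_inv_le {b c σ v : ℝ} (hc : 1 ≤ c) (hσ : 1 ≤ σ) (hb : 1 ≤ b + σ) (hv : 1 < v) :
    tailBeta b c v⁻¹ ≤ 2 * v ^ (σ - 1 / 2) := by
  have hv0 : 0 < v := by linarith
  refine (tailBeta_le hc hσ hb (inv_pos.2 hv0) (inv_le_one_of_one_le₀ hv.le)).trans_eq ?_
  rw [Real.inv_rpow hv0.le, ← Real.rpow_neg hv0.le, neg_sub]

lemma tailBeta_inv_nonneg (b c : ℝ) {v : ℝ} (hv : 1 < v) : 0 ≤ tailBeta b c v⁻¹ :=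
  tailBeta_nonneg b c (inv_pos.2 (by linarith)) (inv_le_one_of_one_le₀ hv.le)

lemma continuousOn_tailBeta_inv (b : ℝ) {c : ℝ} (hc : 1 ≤ c) :
    ContinuousOn (fun v : ℝ => tailBeta b c v⁻¹) (Set.Ioi 0) :=
  (continuousOn_tailBeta b hc).comp (continuousOn_inv₀.mono fun _ hv => (Set.mem_Ioi.1 hv).ne')
    fun _ hv => Set.mem_Ioi.2 (inv_pos.2 (Set.mem_Ioi.1 hv))

lemma continuousOn_betaLaplaceIntegrand (b₁ b₂ z : ℝ) {c : ℝ} (hc : 1 ≤ c) :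
    ContinuousOn (fun v : ℝ => v ^ (b₂ - 1) * Real.exp (-(z * v)) * tailBeta b₁ c v⁻¹)
      (Set.Ioi 1) := by
  refine ContinuousOn.mul (ContinuousOn.mul ?_ (by fun_prop))
    ((continuousOn_tailBeta_inv b₁ hc).mono (Set.Ioi_subset_Ioi zero_le_one))
  exact fun v hv => (Real.continuousAt_rpow_const _ _
    (Or.inl (lt_trans one_pos hv).ne')).continuousWithinAt

lemma betaLaplaceIntegrand_le {b₁ b₂ c σ z z' v : ℝ} (hc : 1 ≤ c) (hσ : 1 ≤ σ)
    (hb : 1 ≤ b₁ + σ) (hz : z' ≤ z) (hv : 1 < v) :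
    ‖v ^ (b₂ - 1) * Real.exp (-(z * v)) * tailBeta b₁ c v⁻¹‖ ≤
      2 * (v ^ (b₂ + σ - 3 / 2) * Real.exp (-(z' * v))) := by
  have hv0 : 0 < v := by linarith
  have h0 := tailBeta_inv_nonneg b₁ c hv
  have h1 := tailBeta_inv_le hc hσ hb hv
  rw [Real.norm_of_nonneg (by positivity)]
  have e : v ^ (b₂ + σ - 3 / 2) = v ^ (b₂ - 1) * v ^ (σ - 1 / 2) := by
    rw [← Real.rpow_add hv0]; ring_nf
  calc _ ≤ v ^ (b₂ - 1) * Real.exp (-(z' * v)) * (2 * v ^ (σ - 1 / 2)) := by gcongr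
    _ = _ := by rw [e]; ring

lemma integrableOn_betaLaplaceIntegrand (b₁ b₂ : ℝ) {c z : ℝ} (hc : 1 ≤ c) (hz : 0 < z) :
    IntegrableOn (fun v : ℝ => v ^ (b₂ - 1) * Real.exp (-(z * v)) * tailBeta b₁ c v⁻¹)
      (Set.Ioi 1) := by
  obtain ⟨σ, hσ, hb⟩ : ∃ σ : ℝ, 1 ≤ σ ∧ 1 ≤ b₁ + σ :=
    ⟨max 1 (1 - b₁), le_max_left _ _, by linarith [le_max_right 1 (1 - b₁)]⟩
  refine Integrable.mono' ((integrableOn_rpow_mul_exp_Ioi_one hz (b₂ + σ - 3 / 2)).const_mul 2)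
    ((continuousOn_betaLaplaceIntegrand b₁ b₂ z hc).aestronglyMeasurable measurableSet_Ioi) ?_
  exact (ae_restrict_mem measurableSet_Ioi).mono fun v hv =>
    betaLaplaceIntegrand_le hc hσ hb le_rfl hv

lemma continuousAt_betaLaplace (b₁ b₂ : ℝ) {c z : ℝ} (hc : 1 ≤ c) (hz : 0 < z) :
    ContinuousAt (betaLaplace b₁ b₂ c) z := by
  obtain ⟨σ, hσ, hb⟩ : ∃ σ : ℝ, 1 ≤ σ ∧ 1 ≤ b₁ + σ :=
    ⟨max 1 (1 - b₁), le_max_left _ _, by linarith [le_max_right 1 (1 - b₁)]⟩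
  refine (Real.continuousAt_rpow_const _ _ (Or.inl hz.ne')).mul ?_
  refine continuousAt_of_dominated
    (bound := fun v => 2 * (v ^ (b₂ + σ - 3 / 2) * Real.exp (-(z / 2 * v)))) ?_ ?_ ?_ ?_
  · exact Eventually.of_forall fun y =>
      (continuousOn_betaLaplaceIntegrand b₁ b₂ y hc).aestronglyMeasurable measurableSet_Ioi
  · filter_upwards [Ioi_mem_nhds (half_lt_self hz)] with y hy
    exact (ae_restrict_mem measurableSet_Ioi).mono fun v hv =>
      betaLaplaceIntegrand_le hc hσ hb (Set.mem_Ioi.1 hy).le hv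
  · exact (integrableOn_rpow_mul_exp_Ioi_one (half_pos hz) _).const_mul 2
  · exact Eventually.of_forall fun v => by fun_prop

/-- The substitution `w = 1/v` in the Mellin integral of the tail. -/
lemma integral_Ioi_cpow_mul_tailBeta_inv {b c : ℝ} {s : ℂ} (hc : 1 ≤ c) (hs : 1 ≤ s.re)
    (hb : 1 ≤ b + s.re) :
    ∫ v in Set.Ioi (1 : ℝ), (v : ℂ) ^ (-s - 1) * (tailBeta b c v⁻¹ : ℂ) =
      1 / s * Complex.betaIntegral (s + b) c := by
  rw [← (integral_cpow_mul_tailBeta hc hs hb).2]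
  let g : ℝ → ℂ := Set.indicator (Set.Ioo 0 1) (fun w => (tailBeta b c w : ℂ))
  have h := mellin_comp_inv g (-s)
  rw [neg_neg, mellin, mellin] at h
  rw [intervalIntegral.integral_of_le zero_le_one, integral_Ioc_eq_integral_Ioo]
  have e1 : ∀ t ∈ Set.Ioi (0 : ℝ), (t : ℂ) ^ (-s - 1) • g t⁻¹ =
      (Set.Ioi (1 : ℝ)).indicator (fun v : ℝ => (v : ℂ) ^ (-s - 1) * (tailBeta b c v⁻¹ : ℂ)) t := by
    intro t ht
    have ht0 : 0 < t := ht
    by_cases h1 : 1 < t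
    · have : t⁻¹ ∈ Set.Ioo (0 : ℝ) 1 := ⟨inv_pos.2 ht0, inv_lt_one_of_one_lt₀ h1⟩
      simp only [g]
      rw [Set.indicator_of_mem this, Set.indicator_of_mem (Set.mem_Ioi.2 h1), smul_eq_mul]
    · have : t⁻¹ ∉ Set.Ioo (0 : ℝ) 1 := fun hh => h1 ((inv_lt_one₀ ht0).1 hh.2)
      simp only [g]
      rw [Set.indicator_of_notMem this, Set.indicator_of_notMem (by simpa using h1), smul_zero]
  have e2 : ∀ t ∈ Set.Ioi (0 : ℝ), (t : ℂ) ^ (s - 1) • g t =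
      (Set.Ioo (0 : ℝ) 1).indicator (fun v : ℝ => (v : ℂ) ^ (s - 1) * (tailBeta b c v : ℂ)) t := by
    intro t ht
    by_cases h1 : t ∈ Set.Ioo (0 : ℝ) 1 <;> simp [g, h1]
  rw [setIntegral_congr_fun measurableSet_Ioi e1, setIntegral_congr_fun measurableSet_Ioi e2,
    setIntegral_indicator measurableSet_Ioi, setIntegral_indicator measurableSet_Ioo] at h
  rwa [Set.inter_eq_right.2 (Set.Ioi_subset_Ioi zero_le_one),
    Set.inter_eq_right.2 Set.Ioo_subset_Ioi_self] at h

/-- Mellin transform of the real-integral form, by exchanging the integrals over `z` and `v`. -/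
lemma mellin_betaLaplace {b₁ b₂ c : ℝ} {s : ℂ} (hc : 1 ≤ c) (hs : 1 ≤ s.re)
    (hb₁ : 1 ≤ b₁ + s.re) (hb₂ : 1 ≤ b₂ + s.re) :
    MellinConvergent (fun z => (betaLaplace b₁ b₂ c z : ℂ)) s ∧
    mellin (fun z => (betaLaplace b₁ b₂ c z : ℂ)) s =
      Complex.Gamma (s + b₂) * (1 / s * Complex.betaIntegral (s + b₁) c) := by
  let F : ℝ × ℝ → ℂ := fun p => (p.1 : ℂ) ^ (s - 1) *
    ((p.1 ^ b₂ * (p.2 ^ (b₂ - 1) * Real.exp (-(p.1 * p.2)) * tailBeta b₁ c p.2⁻¹) : ℝ) : ℂ)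
  let μ : Measure ℝ := volume.restrict (Set.Ioi 0)
  let ν : Measure ℝ := volume.restrict (Set.Ioi 1)
  have hFm : AEStronglyMeasurable F (μ.prod ν) := by
    rw [Measure.prod_restrict]
    refine ContinuousOn.aestronglyMeasurable ?_ (measurableSet_Ioi.prod measurableSet_Ioi)
    refine ContinuousOn.mul ?_ (Complex.continuous_ofReal.comp_continuousOn
      (ContinuousOn.mul ?_ (ContinuousOn.mul (ContinuousOn.mul ?_ (by fun_prop)) ?_)))
    · intro p hp
      exact ((Complex.continuousAt_ofReal_cpow_const _ _ (Or.inr (Set.mem_Ioi.1 hp.1).ne')).comp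
        continuousAt_fst).continuousWithinAt
    · intro p hp
      exact ((Real.continuousAt_rpow_const _ _ (Or.inl (Set.mem_Ioi.1 hp.1).ne')).comp
        continuousAt_fst).continuousWithinAt
    · intro p hp
      exact ((Real.continuousAt_rpow_const _ _
        (Or.inl (lt_trans one_pos (Set.mem_Ioi.1 hp.2)).ne')).comp
        continuousAt_snd).continuousWithinAt
    · exact (continuousOn_tailBeta_inv b₁ hc).comp continuousOn_snd
        fun p hp => lt_trans one_pos (Set.mem_Ioi.1 hp.2)
  have hnorm : ∀ z v : ℝ, 0 < z → 1 < v → ‖F (z, v)‖ =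
      (v ^ (b₂ - 1) * tailBeta b₁ c v⁻¹) * (z ^ (s.re + b₂ - 1) * Real.exp (-(v * z))) := by
    intro z v hz hv
    have hv0 : 0 < v := by linarith
    have h0 := tailBeta_inv_nonneg b₁ c hv
    simp only [F]
    rw [norm_mul, Complex.norm_cpow_eq_rpow_re_of_pos hz, Complex.norm_real,
      Real.norm_of_nonneg (by positivity)]
    have e : z ^ (s.re + b₂ - 1) = z ^ (s - 1).re * z ^ b₂ := by
      rw [← Real.rpow_add hz]; simp only [Complex.sub_re, Complex.one_re]; ring_nf
    rw [e, mul_comm v z]; ring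
  have hFi : Integrable F (μ.prod ν) := by
    rw [integrable_prod_iff' hFm]
    constructor
    · refine (ae_restrict_mem measurableSet_Ioi).mono fun v hv => ?_
      have hv1 : 1 < v := hv
      have hm : AEStronglyMeasurable (fun z => F (z, v)) μ := by
        refine ContinuousOn.aestronglyMeasurable ?_ measurableSet_Ioi
        refine ContinuousOn.mul ?_ (Complex.continuous_ofReal.comp_continuousOn
          (ContinuousOn.mul ?_ (by dsimp only; fun_prop)))
        · exact fun z hz => (Complex.continuousAt_ofReal_cpow_const _ _
            (Or.inr (Set.mem_Ioi.1 hz).ne')).continuousWithinAt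
        · exact fun z hz => (Real.continuousAt_rpow_const _ _
            (Or.inl (Set.mem_Ioi.1 hz).ne')).continuousWithinAt
      rw [← integrable_norm_iff hm]
      have hi := (integrableOn_rpow_mul_exp_neg_mul_rpow (p := 1) (s := s.re + b₂ - 1) (b := v)
        (by linarith) one_pos (by linarith)).const_mul (v ^ (b₂ - 1) * tailBeta b₁ c v⁻¹)
      refine hi.congr ((ae_restrict_mem measurableSet_Ioi).mono fun z hz => ?_)
      beta_reduce
      rw [hnorm z v hz hv1, Real.rpow_one, neg_mul]
    · have hval : ∀ v ∈ Set.Ioi (1 : ℝ), ∫ z, ‖F (z, v)‖ ∂μ =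
          Real.Gamma (s.re + b₂) * (v ^ (-s.re - 1) * tailBeta b₁ c v⁻¹) := by
        intro v hv
        have hv1 : 1 < v := hv
        have hv0 : 0 < v := by linarith
        rw [setIntegral_congr_fun measurableSet_Ioi fun z hz => hnorm z v hz hv1,
          integral_const_mul, Real.integral_rpow_mul_exp_neg_mul_Ioi (by linarith) hv0, one_div,
          Real.inv_rpow hv0.le, ← Real.rpow_neg hv0.le]
        have e : v ^ (-s.re - 1) = v ^ (b₂ - 1) * v ^ (-(s.re + b₂)) := by
          rw [← Real.rpow_add hv0]; ring_nf
        rw [e]; ring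
      have hi : IntegrableOn (fun v : ℝ => Real.Gamma (s.re + b₂) *
          (v ^ (-s.re - 1) * tailBeta b₁ c v⁻¹)) (Set.Ioi 1) := by
        refine Integrable.const_mul ?_ _
        refine Integrable.mono' (g := fun v : ℝ => 2 * v ^ (-(3 / 2) : ℝ))
          ((integrableOn_Ioi_rpow_of_lt (by norm_num) one_pos).const_mul 2) ?_ ?_
        · refine ContinuousOn.aestronglyMeasurable (ContinuousOn.mul ?_
            ((continuousOn_tailBeta_inv b₁ hc).mono (Set.Ioi_subset_Ioi zero_le_one)))
            measurableSet_Ioi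
          exact fun v hv => (Real.continuousAt_rpow_const _ _
            (Or.inl (lt_trans one_pos hv).ne')).continuousWithinAt
        · refine (ae_restrict_mem measurableSet_Ioi).mono fun v hv => ?_
          have hv1 : 1 < v := hv
          have hv0 : 0 < v := by linarith
          have h0 := tailBeta_inv_nonneg b₁ c hv
          have h1 := tailBeta_inv_le hc hs hb₁ hv
          rw [Real.norm_of_nonneg (by positivity)]
          calc _ ≤ v ^ (-s.re - 1) * (2 * v ^ (s.re - 1 / 2)) := by gcongr
            _ = 2 * (v ^ (-s.re - 1) * v ^ (s.re - 1 / 2)) := by ring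
            _ = _ := by rw [← Real.rpow_add hv0]; ring_nf
      exact hi.congr ((ae_restrict_mem measurableSet_Ioi).mono fun v hv => (hval v hv).symm)
  have hinner : ∀ z : ℝ, (z : ℂ) ^ (s - 1) • ((betaLaplace b₁ b₂ c z : ℝ) : ℂ) =
      ∫ v, F (z, v) ∂ν := by
    intro z
    simp only [F]
    rw [integral_const_mul, smul_eq_mul, betaLaplace, ← integral_const_mul,
      ← integral_complex_ofReal]
  constructor
  · have := hFi.integral_prod_left
    exact this.congr (Eventually.of_forall fun z => (hinner z).symm)
  · rw [mellin]
    simp_rw [hinner]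
    rw [integral_integral_swap (f := fun z v => F (z, v)) hFi,
      ← integral_Ioi_cpow_mul_tailBeta_inv hc hs hb₁, ← integral_const_mul]
    refine setIntegral_congr_fun measurableSet_Ioi fun v hv => ?_
    have hv0 : 0 < v := lt_trans one_pos hv
    have h1 : ∀ z ∈ Set.Ioi (0 : ℝ), F (z, v) = ((v : ℂ) ^ ((b₂ : ℂ) - 1) * tailBeta b₁ c v⁻¹) *
        ((z : ℂ) ^ (s + b₂ - 1) * Complex.exp (-(v * z))) := by
      intro z hz
      have hz0 : 0 < z := hz
      have e : (z : ℂ) ^ (s + b₂ - 1) = (z : ℂ) ^ (s - 1) * (z : ℂ) ^ (b₂ : ℂ) := by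
        rw [← Complex.cpow_add _ _ (by exact_mod_cast hz0.ne')]; ring_nf
      simp only [F]
      rw [e]
      push_cast [Complex.ofReal_cpow hz0.le, Complex.ofReal_cpow hv0.le]
      rw [mul_comm (v : ℂ) z]; ring
    rw [setIntegral_congr_fun measurableSet_Ioi h1, integral_const_mul,
      Complex.integral_cpow_mul_exp_neg_mul_Ioi (by simp; linarith) hv0]
    have hvC : (v : ℂ) ≠ 0 := by exact_mod_cast hv0.ne'
    have e1 : (1 / (v : ℂ)) ^ (s + b₂) = (v : ℂ) ^ (-(s + b₂)) := by
      rw [one_div, Complex.inv_cpow _ _ (by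
        rw [Complex.arg_ofReal_of_nonneg hv0.le]; exact Real.pi_pos.ne), Complex.cpow_neg]
    have e2 : (v : ℂ) ^ (-s - 1) = (v : ℂ) ^ ((b₂ : ℂ) - 1) * (v : ℂ) ^ (-(s + b₂)) := by
      rw [← Complex.cpow_add _ _ hvC]; ring_nf
    rw [e1, e2]; ring

lemma norm_Gamma_le {s : ℂ} (hs : 0 < s.re) : ‖Complex.Gamma s‖ ≤ Real.Gamma s.re := by
  rw [Complex.Gamma_eq_integral hs, Real.Gamma_eq_integral hs, Complex.GammaIntegral]
  refine (norm_integral_le_integral_norm _).trans_eq ?_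
  refine setIntegral_congr_fun measurableSet_Ioi fun x hx => ?_
  rw [norm_mul, Complex.norm_real, Complex.norm_cpow_eq_rpow_re_of_pos hx,
    Real.norm_of_nonneg (Real.exp_pos _).le, Complex.sub_re, Complex.one_re]

lemma one_add_sq_le_normSq {u : ℂ} (hu : 1 ≤ u.re) : 1 + u.im ^ 2 ≤ ‖u‖ ^ 2 := by
  rw [Complex.sq_norm, Complex.normSq_apply]
  nlinarith

lemma norm_betaIntegral_le_one {u v : ℂ} (hu : 1 ≤ u.re) (hv : 1 ≤ v.re) :
    ‖Complex.betaIntegral u v‖ ≤ 1 := by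
  have h := intervalIntegral.norm_integral_le_of_norm_le_const (a := (0 : ℝ)) (b := 1) (C := 1)
    (f := fun x : ℝ => (x : ℂ) ^ (u - 1) * (1 - (x : ℂ)) ^ (v - 1)) ?_
  · simpa [Complex.betaIntegral] using h
  · intro x hx
    rw [Set.uIoc_of_le zero_le_one] at hx
    rcases eq_or_lt_of_le hx.2 with rfl | hx1
    · simp only [Complex.ofReal_one, Complex.one_cpow, one_mul, sub_self]
      by_cases h : v - 1 = 0
      · simp [h]
      · simp [Complex.zero_cpow h]
    · have e : (1 - (x : ℂ)) = ((1 - x : ℝ) : ℂ) := by push_cast; ring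
      rw [e, norm_mul, Complex.norm_cpow_eq_rpow_re_of_pos hx.1,
        Complex.norm_cpow_eq_rpow_re_of_pos (by linarith)]
      exact mul_le_one₀ (Real.rpow_le_one hx.1.le hx.2 (by simpa using hu)) (by
        have : 0 ≤ 1 - x := by linarith
        positivity)
        (Real.rpow_le_one (by linarith) (by linarith [hx.1]) (by simpa using hv))

/-- The Mellin transform decays like `|y|⁻²` along vertical lines: one factor comes from `1 / s` and
one from `Γ(s) = Γ(s + 1) / s`. -/
lemma verticalIntegrable_mellin_betaLaplace {b₁ b₂ c σ : ℝ} (hc : 1 ≤ c) (hσ : 1 ≤ σ)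
    (hb₁ : 1 ≤ b₁ + σ) (hb₂ : 1 ≤ b₂ + σ) :
    Complex.VerticalIntegrable (mellin fun z => (betaLaplace b₁ b₂ c z : ℂ)) σ := by
  have hre : ∀ y : ℝ, ((σ : ℂ) + y * Complex.I).re = σ := fun y => by simp
  have heq : (fun y : ℝ => mellin (fun z => (betaLaplace b₁ b₂ c z : ℂ)) (σ + y * Complex.I)) =
      fun y : ℝ => Complex.Gamma (σ + y * Complex.I + b₂) * (1 / (σ + y * Complex.I) *
        (Complex.Gamma (σ + y * Complex.I + b₁) * Complex.Gamma c /
          Complex.Gamma (σ + y * Complex.I + b₁ + c))) := by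
    funext y
    rw [(mellin_betaLaplace hc (by rwa [hre]) (by rwa [hre]) (by rwa [hre])).2,
      Complex.betaIntegral_eq_Gamma_mul_div _ _ (by simp; linarith) (by simp; linarith)]
  have hcont : ∀ r : ℝ, 0 < σ + r →
      Continuous fun y : ℝ => Complex.Gamma (σ + y * Complex.I + r) := by
    intro r hr
    rw [continuous_iff_continuousAt]
    intro y
    refine ContinuousAt.comp (g := Complex.Gamma) ?_ (by fun_prop)
    refine (Complex.differentiableAt_Gamma _ fun m h => ?_).continuousAt
    have := congrArg Complex.re h
    simp at this
    have hm : (0 : ℝ) ≤ m := m.cast_nonneg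
    linarith
  have hcont2 : Continuous fun y : ℝ => Complex.Gamma (σ + y * Complex.I + b₁ + c) := by
    have := hcont (b₁ + c) (by linarith)
    refine this.congr fun y => ?_
    push_cast; ring_nf
  have hne : ∀ y : ℝ, Complex.Gamma (σ + y * Complex.I + b₁ + c) ≠ 0 := fun y =>
    Complex.Gamma_ne_zero_of_re_pos (by simp; linarith)
  have hne0 : ∀ y : ℝ, (σ + y * Complex.I : ℂ) ≠ 0 := fun y h => by
    have := congrArg Complex.re h
    simp at this
    linarith
  refine Integrable.mono' (g := fun y : ℝ => Real.Gamma (σ + b₂ + 1) * (1 + y ^ 2)⁻¹)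
    (integrable_inv_one_add_sq.const_mul _) ?_ ?_
  · rw [heq]
    refine Continuous.aestronglyMeasurable ?_
    have h1 := hcont b₂ (by linarith)
    have h2 := hcont b₁ (by linarith)
    have h3 : Continuous fun y : ℝ => (1 / (σ + y * Complex.I) : ℂ) :=
      Continuous.div continuous_const (by fun_prop) hne0
    exact h1.mul (h3.mul ((h2.mul continuous_const).div hcont2 hne))
  · refine Eventually.of_forall fun y => ?_
    rw [(mellin_betaLaplace hc (by rwa [hre]) (by rwa [hre]) (by rwa [hre])).2]
    set s : ℂ := σ + y * Complex.I with hs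
    have hsre : s.re = σ := hre y
    have hsim : s.im = y := by simp [hs]
    have hu : 1 ≤ (s + b₂).re := by simp [hsre]; linarith
    have hu0 : s + b₂ ≠ 0 := by
      intro h; rw [h] at hu; simp at hu; linarith
    have hG : Complex.Gamma (s + b₂) = Complex.Gamma (s + b₂ + 1) / (s + b₂) := by
      rw [Complex.Gamma_add_one _ hu0]; field_simp
    have hG1 : ‖Complex.Gamma (s + b₂ + 1)‖ ≤ Real.Gamma (σ + b₂ + 1) := by
      have := norm_Gamma_le (s := s + b₂ + 1) (by simp [hsre]; linarith)
      simpa [hsre] using this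
    have hB : ‖Complex.betaIntegral (s + b₁) c‖ ≤ 1 :=
      norm_betaIntegral_le_one (by simp [hsre]; linarith) (by simpa using hc)
    have hGp : 0 < Real.Gamma (σ + b₂ + 1) := Real.Gamma_pos_of_pos (by linarith)
    have n1 := one_add_sq_le_normSq (u := s) (by rw [hsre]; exact hσ)
    have n2 := one_add_sq_le_normSq hu
    simp only [Complex.add_im, Complex.ofReal_im, add_zero, hsim] at n1 n2
    have hs0 : 0 < ‖s‖ := norm_pos_iff.2 (hne0 y)
    have hsb0 : 0 < ‖s + b₂‖ := norm_pos_iff.2 hu0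
    have n3 : 1 + y ^ 2 ≤ ‖s + b₂‖ * ‖s‖ := by
      refine le_of_sq_le_sq ?_ (by positivity)
      rw [mul_pow, sq (1 + y ^ 2)]
      gcongr
    rw [hG]
    simp only [norm_mul, norm_div, norm_one]
    calc ‖Complex.Gamma (s + b₂ + 1)‖ / ‖s + b₂‖ * (1 / ‖s‖ * ‖Complex.betaIntegral (s + b₁) c‖)
        ≤ Real.Gamma (σ + b₂ + 1) / ‖s + b₂‖ * (1 / ‖s‖ * 1) := by gcongr
      _ = Real.Gamma (σ + b₂ + 1) * (‖s + b₂‖ * ‖s‖)⁻¹ := by field_simp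
      _ ≤ _ := by gcongr

/-- On the contour, `Γ(-t) / Γ(1 - t) = -1 / t` and `Γ(b₁ - t) / Γ(b₁ + c - t)` is a beta integral,
so with `s = -t` the Mellin–Barnes integrand is the Mellin transform of `betaLaplace`, and Mellin
inversion applies. -/
theorem meijerG_eq_betaLaplace (b₁ b₂ : ℝ) {c z : ℝ} (hc : 1 ≤ c) (hz : 0 < z) :
    meijerG 1 (b₁ + c) b₁ b₂ 0 z = 1 / Real.Gamma c * betaLaplace b₁ b₂ c z := by
  set m : ℝ := min b₁ (min b₂ 0) - 1 with hm
  have hσ : 1 ≤ -m := by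
    have : min b₁ (min b₂ 0) ≤ 0 := (min_le_right _ _).trans (min_le_right _ _)
    linarith
  have hb₁ : 1 ≤ b₁ + -m := by
    have : min b₁ (min b₂ 0) ≤ b₁ := min_le_left _ _
    linarith
  have hb₂ : 1 ≤ b₂ + -m := by
    have : min b₁ (min b₂ 0) ≤ b₂ := (min_le_right _ _).trans (min_le_left _ _)
    linarith
  have hre : ∀ y : ℝ, (((-m : ℝ) : ℂ) + y * Complex.I).re = -m := fun y => by simp
  have hinv := mellinInv_mellin_eq (-m) (fun z => (betaLaplace b₁ b₂ c z : ℂ)) hz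
    (mellin_betaLaplace hc (by simpa using hσ) (by simpa using hb₁) (by simpa using hb₂)).1
    (verticalIntegrable_mellin_betaLaplace hc hσ hb₁ hb₂)
    (Complex.continuous_ofReal.continuousAt.comp (continuousAt_betaLaplace b₁ b₂ hc hz))
  have hΓc : Complex.Gamma c ≠ 0 :=
    Complex.Gamma_ne_zero_of_re_pos (by simp; linarith)
  have hpt : ∀ y : ℝ, meijerIntegrand 1 (b₁ + c) b₁ b₂ 0 z ((m : ℂ) + ((-y : ℝ) : ℂ) * Complex.I) =
      1 / Complex.Gamma c * ((z : ℂ) ^ (-(((-m : ℝ) : ℂ) + y * Complex.I)) •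
        mellin (fun z => (betaLaplace b₁ b₂ c z : ℂ)) (((-m : ℝ) : ℂ) + y * Complex.I)) := by
    intro y
    rw [(mellin_betaLaplace hc (by rwa [hre]) (by rwa [hre]) (by rwa [hre])).2,
      Complex.betaIntegral_eq_Gamma_mul_div _ _ (by simp; linarith) (by simp; linarith)]
    set s : ℂ := ((-m : ℝ) : ℂ) + y * Complex.I with hs
    have ht : (m : ℂ) + ((-y : ℝ) : ℂ) * Complex.I = -s := by rw [hs]; push_cast; ring
    have hs0 : s ≠ 0 := by
      intro h; have := hre y; rw [← hs, h] at this; simp at this; linarith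
    have hΓs : Complex.Gamma s ≠ 0 := Complex.Gamma_ne_zero_of_re_pos (by rw [hs, hre]; linarith)
    have hΓ : Complex.Gamma (s + b₁ + c) ≠ 0 :=
      Complex.Gamma_ne_zero_of_re_pos (by
        rw [Complex.add_re, Complex.add_re, hs, hre]; simp; linarith)
    have e1 : ((1 : ℝ) : ℂ) - -s = s + 1 := by push_cast; ring
    have e2 : ((b₁ + c : ℝ) : ℂ) - -s = s + b₁ + c := by push_cast; ring
    have e3 : (b₁ : ℂ) - -s = s + b₁ := by ring
    have e4 : (b₂ : ℂ) - -s = s + b₂ := by ring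
    have e5 : ((0 : ℝ) : ℂ) - -s = s := by push_cast; ring
    rw [ht, meijerIntegrand, e1, e2, e3, e4, e5, Complex.Gamma_add_one _ hs0, smul_eq_mul]
    field_simp
  have hint : ∫ y : ℝ, meijerIntegrand 1 (b₁ + c) b₁ b₂ 0 z ((m : ℂ) + (y : ℂ) * Complex.I) =
      1 / Complex.Gamma c * ∫ y : ℝ, (z : ℂ) ^ (-(((-m : ℝ) : ℂ) + y * Complex.I)) •
        mellin (fun z => (betaLaplace b₁ b₂ c z : ℂ)) (((-m : ℝ) : ℂ) + y * Complex.I) := by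
    rw [← integral_const_mul, ← integral_neg_eq_self]
    exact integral_congr_ae (Eventually.of_forall hpt)
  rw [mellinInv] at hinv
  rw [meijerG, ← hm, hint]
  have : (1 / (2 * (Real.pi : ℂ)) * (1 / Complex.Gamma c *
      ∫ y : ℝ, (z : ℂ) ^ (-(((-m : ℝ) : ℂ) + y * Complex.I)) •
        mellin (fun z => (betaLaplace b₁ b₂ c z : ℂ)) (((-m : ℝ) : ℂ) + y * Complex.I))) =
      ((1 / Real.Gamma c * betaLaplace b₁ b₂ c z : ℝ) : ℂ) := by
    push_cast
    rw [← hinv, Complex.Gamma_ofReal, Complex.real_smul]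
    push_cast
    ring
  rw [this, Complex.ofReal_re]

/-! ### The closed form as a weighted average -/

lemma xi_pos {α ν : ℝ} (hα : 1 / 2 < α) (hν : 0 < ν) : 0 < xi α ν := by
  unfold xi
  have : 0 < 2 * α - 1 := by linarith
  have : 0 < α := by linarith
  have := Real.pi_pos
  positivity

/-- The coefficient of `w^(4a-2)` in the clustering profile that does not come from the G-function.
-/
def tailCoeff (a : ℝ) : ℝ :=
  4 * ((2 : ℝ) ^ (-4 * a) * (3 * a - 1) / (a - 1) +
    (a - 1 / 2) * lowerBeta (1 / 2) (1 + 2 * a) (-2 + 2 * a))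

/-- The clustering profile for `a ≠ 1`: the probability that two random neighbours of a vertex of
expected degree `x / w` are adjacent, where `x = xi a ν`. -/
def closedProfile (a w : ℝ) : ℝ :=
  1 / (8 * a * (a - 1)) *
    (-1 + 8 * a * (a - 1 / 2) * w - 2 * (a * (a - 1 / 2) ^ 2 / (a - 1)) * w ^ 2
      + tailCoeff a * w ^ (4 * a - 2) + (1 - w) ^ (2 * a)
      - 2 * a * (w ^ (4 * a - 2) * tailBeta (3 - 4 * a) (2 * a) w))

/-- The average of the profile `f`, as a function of `w = 1/v`, under the weight
`v^(k-2a-1) e^(-xv)` on `(1, ∞)`. -/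
def profileMean (a x : ℝ) (k : ℕ) (f : ℝ → ℝ) : ℝ :=
  (∫ v in Set.Ioi (1 : ℝ), v ^ ((k : ℝ) - 2 * a - 1) * Real.exp (-(x * v)) * f v⁻¹) /
    expMoment x (k - 2 * a - 1)

lemma integrableOn_weight_mul {x : ℝ} (hx : 0 < x) (s : ℝ) {f : ℝ → ℝ} {C : ℝ}
    (hf : ContinuousOn f (Set.Ioc 0 1)) (hC : ∀ w ∈ Set.Ioc (0 : ℝ) 1, |f w| ≤ C) :
    IntegrableOn (fun v : ℝ => v ^ s * Real.exp (-(x * v)) * f v⁻¹) (Set.Ioi 1) := by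
  have hmem : ∀ v ∈ Set.Ioi (1 : ℝ), v⁻¹ ∈ Set.Ioc (0 : ℝ) 1 := fun v hv =>
    ⟨inv_pos.2 (lt_trans one_pos hv), inv_le_one_of_one_le₀ (Set.mem_Ioi.1 hv).le⟩
  refine Integrable.mul_bdd (c := C) (integrableOn_rpow_mul_exp_Ioi_one hx s) ?_ ?_
  · refine ContinuousOn.aestronglyMeasurable ?_ measurableSet_Ioi
    exact hf.comp (continuousOn_inv₀.mono fun _ hv => (lt_trans one_pos hv).ne') hmem
  · exact (ae_restrict_mem measurableSet_Ioi).mono fun v hv => hC _ (hmem v hv)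

lemma exp_mul_tricomiU {a x : ℝ} (ha : 1 / 2 < a) (k : ℕ) :
    Real.Gamma (2 * a + 1) * Real.exp (-x) * tricomiU (2 * a + 1) (1 + k - 2 * a) x =
      ∫ v in Set.Ioi (1 : ℝ), v ^ ((k : ℝ) - 2 * a - 1) * Real.exp (-(x * v)) *
        (1 - v⁻¹) ^ (2 * a) := by
  have hG : Real.Gamma (2 * a + 1) ≠ 0 := (Real.Gamma_pos_of_pos (by linarith)).ne'
  have hsh := (measurePreserving_add_right volume (1 : ℝ)).setIntegral_preimage_emb
    (measurableEmbedding_addRight (1 : ℝ))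
    (fun v : ℝ => v ^ ((k : ℝ) - 2 * a - 1) * Real.exp (-(x * v)) * (1 - v⁻¹) ^ (2 * a))
    (Set.Ioi 1)
  simp only [Set.preimage_add_const_Ioi, sub_self] at hsh
  rw [← hsh, tricomiU, mul_comm (Real.Gamma _), mul_assoc, ← mul_assoc (Real.Gamma _),
    mul_one_div_cancel hG, one_mul, ← integral_const_mul]
  refine setIntegral_congr_fun measurableSet_Ioi fun t ht => ?_
  have ht0 : 0 < t := ht
  have h1 : (0 : ℝ) < t + 1 := by linarith
  have e1 : 1 - (t + 1)⁻¹ = t / (t + 1) := by field_simp; ring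
  have e2 : (t + 1) ^ ((k : ℝ) - 2 * a - 1) =
      (t + 1) ^ (1 + (k : ℝ) - 2 * a - (2 * a + 1) - 1) * (t + 1) ^ (2 * a) := by
    rw [← Real.rpow_add h1]; ring_nf
  have e3 : Real.exp (-(x * (t + 1))) = Real.exp (-x) * Real.exp (-(x * t)) := by
    rw [← Real.exp_add]; ring_nf
  have e4 := (Real.rpow_pos_of_pos h1 (2 * a)).ne'
  rw [e1, e2, e3, Real.div_rpow ht0.le h1.le, add_comm 1 t, add_sub_cancel_right]
  field_simp

theorem gammaClosed_eq_profileMean {a ν : ℝ} (ha : 1 / 2 < a) (ha1 : a ≠ 1) (hν : 0 < ν) (k : ℕ) :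
    gammaClosed a ν k = profileMean a (xi a ν) k (closedProfile a) := by
  have hx := xi_pos ha hν
  set x := xi a ν
  set s : ℝ := (k : ℝ) - 2 * a - 1 with hs
  have ha0 : a ≠ 0 := by linarith
  have ha1' : a - 1 ≠ 0 := sub_ne_zero.2 ha1
  have hm := expMoment_pos hx s
  have hxp := Real.rpow_pos_of_pos hx ((k : ℝ) - 2 * a)
  -- the six terms, each brought to the common factor `x^(k-2a)`
  have g0 : upperGamma (k - 2 * a) x = x ^ ((k : ℝ) - 2 * a) * expMoment x s :=
    upperGamma_eq_expMoment hx _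
  have g1 : x * upperGamma (k - 2 * a - 1) x = x ^ ((k : ℝ) - 2 * a) * expMoment x (s - 1) := by
    rw [upperGamma_eq_expMoment hx, Real.rpow_sub_one hx.ne']
    field_simp
    rfl
  have g2 : x ^ 2 * upperGamma (k - 2 * a - 2) x =
      x ^ ((k : ℝ) - 2 * a) * expMoment x (s - 2) := by
    have e : (k : ℝ) - 2 * a - 2 - 1 = s - 2 := by rw [hs]; ring
    have e2 : x ^ ((k : ℝ) - 2 * a) = x ^ 2 * x ^ ((k : ℝ) - 2 * a - 2) := by
      rw [← Real.rpow_natCast, ← Real.rpow_add hx]; push_cast; ring_nf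
    rw [upperGamma_eq_expMoment hx, e, e2]
    ring
  have hpw : x ^ (4 * a - 2) * x ^ ((k : ℝ) - 6 * a + 2) = x ^ ((k : ℝ) - 2 * a) := by
    rw [← Real.rpow_add hx]; ring_nf
  have g3 : x ^ (4 * a - 2) * upperGamma (k - 6 * a + 2) x =
      x ^ ((k : ℝ) - 2 * a) * expMoment x (s - (4 * a - 2)) := by
    have e : (k : ℝ) - 6 * a + 2 - 1 = s - (4 * a - 2) := by rw [hs]; ring
    rw [upperGamma_eq_expMoment hx, e, ← mul_assoc, hpw]
  have g4 := exp_mul_tricomiU (x := x) ha k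
  have g5 : x ^ (4 * a - 2) * Real.Gamma (2 * a + 1) *
      meijerG 1 (3 - 2 * a) (3 - 4 * a) (-6 * a + k + 2) 0 x = x ^ ((k : ℝ) - 2 * a) * (2 * a *
        ∫ v in Set.Ioi (1 : ℝ), v ^ (s - (4 * a - 2)) * Real.exp (-(x * v)) *
          tailBeta (3 - 4 * a) (2 * a) v⁻¹) := by
    have e1 : 3 - 2 * a = (3 - 4 * a) + 2 * a := by ring
    have e2 : -6 * a + k + 2 = (k : ℝ) - 6 * a + 2 := by ring
    have e3 : (k : ℝ) - 6 * a + 2 - 1 = s - (4 * a - 2) := by rw [hs]; ring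
    have hG : Real.Gamma (2 * a) ≠ 0 := (Real.Gamma_pos_of_pos (by linarith)).ne'
    rw [e1, e2, meijerG_eq_betaLaplace _ _ (by linarith) hx, Real.Gamma_add_one (by linarith),
      betaLaplace, e3, ← hpw]
    field_simp
  -- integrability of the terms of the profile
  have i0 := integrableOn_rpow_mul_exp_Ioi_one hx s
  have i0' : IntegrableOn (fun v : ℝ => -(v ^ s * Real.exp (-(x * v)))) (Set.Ioi 1) := i0.neg
  have i1 := integrableOn_rpow_mul_exp_Ioi_one hx (s - 1)
  have i2 := integrableOn_rpow_mul_exp_Ioi_one hx (s - 2)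
  have i3 := integrableOn_rpow_mul_exp_Ioi_one hx (s - (4 * a - 2))
  have i4 : IntegrableOn (fun v : ℝ => v ^ s * Real.exp (-(x * v)) * (1 - v⁻¹) ^ (2 * a))
      (Set.Ioi 1) := by
    refine integrableOn_weight_mul hx s (f := fun w => (1 - w) ^ (2 * a)) (C := 1) ?_ ?_
    · exact ((Real.continuous_rpow_const (by linarith)).comp
        (continuous_const.sub continuous_id)).continuousOn
    · intro w hw
      have : 0 ≤ 1 - w := by linarith [hw.2]
      rw [abs_of_nonneg (by positivity)]
      exact Real.rpow_le_one this (by linarith [hw.1]) (by linarith)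
  have i5 : IntegrableOn (fun v : ℝ => v ^ (s - (4 * a - 2)) * Real.exp (-(x * v)) *
      tailBeta (3 - 4 * a) (2 * a) v⁻¹) (Set.Ioi 1) := by
    have := integrableOn_betaLaplaceIntegrand (3 - 4 * a) (s - (4 * a - 2) + 1)
      (c := 2 * a) (by linarith) hx
    simpa using this
  have hint : ∫ v in Set.Ioi (1 : ℝ), v ^ s * Real.exp (-(x * v)) * closedProfile a v⁻¹ =
      1 / (8 * a * (a - 1)) * (-expMoment x s + 8 * a * (a - 1 / 2) * expMoment x (s - 1)
        - 2 * (a * (a - 1 / 2) ^ 2 / (a - 1)) * expMoment x (s - 2)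
        + tailCoeff a * expMoment x (s - (4 * a - 2))
        + (∫ v in Set.Ioi (1 : ℝ), v ^ s * Real.exp (-(x * v)) * (1 - v⁻¹) ^ (2 * a))
        - 2 * a * ∫ v in Set.Ioi (1 : ℝ), v ^ (s - (4 * a - 2)) * Real.exp (-(x * v)) *
          tailBeta (3 - 4 * a) (2 * a) v⁻¹) := by
    simp only [expMoment]
    rw [← integral_neg, ← integral_const_mul (8 * a * (a - 1 / 2)),
      ← integral_const_mul (2 * (a * (a - 1 / 2) ^ 2 / (a - 1))),
      ← integral_const_mul (tailCoeff a), ← integral_const_mul (2 * a),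
      ← integral_add i0' (i1.const_mul _), ← integral_sub _ (i2.const_mul _),
      ← integral_add _ (i3.const_mul _), ← integral_add _ i4, ← integral_sub _ (i5.const_mul _),
      ← integral_const_mul]
    · refine setIntegral_congr_fun measurableSet_Ioi fun v hv => ?_
      have hv0 : 0 < v := lt_trans one_pos hv
      have e1 : v ^ (s - 1) = v ^ s * v⁻¹ := by rw [Real.rpow_sub_one hv0.ne', div_eq_mul_inv]
      have e2 : v ^ (s - 2) = v ^ s * v⁻¹ ^ 2 := by
        rw [Real.rpow_sub hv0]
        norm_cast
        rw [inv_pow, div_eq_mul_inv]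
      have e3 : v ^ (s - (4 * a - 2)) = v ^ s * v⁻¹ ^ (4 * a - 2) := by
        rw [Real.rpow_sub hv0, Real.inv_rpow hv0.le, div_eq_mul_inv]
      rw [e1, e2, e3, closedProfile]
      ring
    · exact (((i0'.add (i1.const_mul _)).sub (i2.const_mul _)).add (i3.const_mul _)).add i4
    · exact ((i0'.add (i1.const_mul _)).sub (i2.const_mul _)).add (i3.const_mul _)
    · exact (i0'.add (i1.const_mul _)).sub (i2.const_mul _)
    · exact i0'.add (i1.const_mul _)
  rw [profileMean, ← hs, hint, gammaClosed, tailCoeff]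
  change 1 / (8 * a * (a - 1) * upperGamma (k - 2 * a) x) * (-upperGamma (k - 2 * a) x
      - 2 * (a * (a - 1 / 2) ^ 2 * x ^ 2 * upperGamma (k - 2 * a - 2) x / (a - 1))
      + 8 * a * (a - 1 / 2) * x * upperGamma (k - 2 * a - 1) x
      + 4 * x ^ (4 * a - 2) * upperGamma (k - 6 * a + 2) x *
          ((2 : ℝ) ^ (-4 * a) * (3 * a - 1) / (a - 1)
            + (a - 1 / 2) * lowerBeta (1 / 2) (1 + 2 * a) (-2 + 2 * a))
      + x ^ ((k : ℝ) - 2 * a) * Real.Gamma (2 * a + 1) * Real.exp (-x) *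
          tricomiU (2 * a + 1) (1 + k - 2 * a) x
      - x ^ (4 * a - 2) * Real.Gamma (2 * a + 1) *
          meijerG 1 (3 - 2 * a) (3 - 4 * a) (-6 * a + k + 2) 0 x) = _
  rw [g5]
  have r2 : a * (a - 1 / 2) ^ 2 * x ^ 2 * upperGamma (k - 2 * a - 2) x =
      a * (a - 1 / 2) ^ 2 * (x ^ ((k : ℝ) - 2 * a) * expMoment x (s - 2)) := by
    rw [← g2]; ring
  have r1 : 8 * a * (a - 1 / 2) * x * upperGamma (k - 2 * a - 1) x =
      8 * a * (a - 1 / 2) * (x ^ ((k : ℝ) - 2 * a) * expMoment x (s - 1)) := by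
    rw [← g1]; ring
  have r3 : 4 * x ^ (4 * a - 2) * upperGamma (k - 6 * a + 2) x =
      4 * (x ^ ((k : ℝ) - 2 * a) * expMoment x (s - (4 * a - 2))) := by
    rw [← g3]; ring
  have r4 : x ^ ((k : ℝ) - 2 * a) * Real.Gamma (2 * a + 1) * Real.exp (-x) *
      tricomiU (2 * a + 1) (1 + k - 2 * a) x = x ^ ((k : ℝ) - 2 * a) *
        ∫ v in Set.Ioi (1 : ℝ), v ^ s * Real.exp (-(x * v)) * (1 - v⁻¹) ^ (2 * a) := by
    rw [← g4]; ring
  rw [r1, r2, r3, r4, g0]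
  field_simp
  ring

/-! ### A representation of the profile that is regular at `a = 1` -/

/-- The right-hand side of the differential equation of the profile, before division by a multiple
of `a - 1`; it vanishes at `a = 1`. -/
def sourceNumer (x a : ℝ) : ℝ :=
  1 - (1 - x) ^ (2 * a) - 2 * a * (4 * a - 3) * x + a * (2 * a - 1) * x ^ 2

/-- The derivative of `sourceNumer x a` with respect to `a`. -/
def sourceNumerDeriv (x a : ℝ) : ℝ :=
  -(2 * (Real.log (1 - x) * (1 - x) ^ (2 * a))) - (16 * a - 6) * x + (4 * a - 1) * x ^ 2

/-- The source `E` in `(w^(2-4a) φ(w))' = w^(1-4a) E(w)`, where `φ` is the clustering profile;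
at `a = 1` the difference quotient is replaced by the derivative. -/
def profileSource (a x : ℝ) : ℝ :=
  if a = 1 then 1 / 4 * sourceNumerDeriv x 1
  else (2 * a - 1) / (4 * a * (a - 1)) * sourceNumer x a

/-- The value of the clustering profile at `w = 1`, extended to `a = 1` by continuity. -/
def profileEnd (a : ℝ) : ℝ :=
  if a = 1 then limUnder (𝓝[≠] (1 : ℝ)) (fun a => closedProfile a 1) else closedProfile a 1

/-- The clustering profile for all `a > 1/2`, obtained by integrating its differential equation from
the end `w = 1`. -/
def profile (a w : ℝ) : ℝ :=
  w ^ (4 * a - 2) * (profileEnd a - ∫ x in w..1, x ^ (1 - 4 * a) * profileSource a x)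

lemma hasDerivAt_one_sub_rpow {a : ℝ} (ha : 1 / 2 < a) (w : ℝ) :
    HasDerivAt (fun w : ℝ => (1 - w) ^ (2 * a)) (-(2 * a * (1 - w) ^ (2 * a - 1))) w := by
  have h := ((hasDerivAt_id w).const_sub 1).rpow_const (p := 2 * a) (Or.inr (by linarith))
  simpa using h

lemma continuous_sourceNumer {a : ℝ} (ha : 1 / 2 < a) : Continuous fun x => sourceNumer x a := by
  have h : Continuous fun w : ℝ => (1 - w) ^ (2 * a) :=
    continuous_iff_continuousAt.2 fun w => (hasDerivAt_one_sub_rpow ha w).continuousAt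
  unfold sourceNumer
  fun_prop

lemma continuous_profileSource {a : ℝ} (ha : 1 / 2 < a) : Continuous (profileSource a) := by
  by_cases h1 : a = 1
  · have h : Continuous fun x : ℝ => Real.log (1 - x) * (1 - x) ^ ((2 : ℝ) * 1) := by
      have h2 : Continuous fun x : ℝ => (1 - x) * ((1 - x) * Real.log (1 - x)) :=
        (continuous_const.sub continuous_id).mul
          (Real.continuous_mul_log.comp (continuous_const.sub continuous_id))
      refine h2.congr fun x => ?_
      rw [mul_one, show (2 : ℝ) = ((2 : ℕ) : ℝ) by norm_num, Real.rpow_natCast]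
      ring
    have : profileSource a = fun x => 1 / 4 * sourceNumerDeriv x 1 := by
      funext x; simp [profileSource, h1]
    rw [this]
    unfold sourceNumerDeriv
    fun_prop
  · have : profileSource a = fun x => (2 * a - 1) / (4 * a * (a - 1)) * sourceNumer x a := by
      funext x; simp [profileSource, h1]
    rw [this]
    exact continuous_const.mul (continuous_sourceNumer ha)

lemma continuousOn_rpow_mul_profileSource {a : ℝ} (ha : 1 / 2 < a) :
    ContinuousOn (fun x : ℝ => x ^ (1 - 4 * a) * profileSource a x) (Set.Ioi 0) :=
  ContinuousOn.mul (fun _ hx => (Real.continuousAt_rpow_const _ _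
    (Or.inl (Set.mem_Ioi.1 hx).ne')).continuousWithinAt) (continuous_profileSource ha).continuousOn

lemma continuousOn_profile {a : ℝ} (ha : 1 / 2 < a) : ContinuousOn (profile a) (Set.Ioi 0) := by
  intro w hw
  refine ContinuousAt.continuousWithinAt (ContinuousAt.mul ?_ (continuousAt_const.sub ?_))
  · exact Real.continuousAt_rpow_const _ _ (Or.inl (Set.mem_Ioi.1 hw).ne')
  · exact (hasDerivAt_integral_to_one (continuousOn_rpow_mul_profileSource ha) hw).continuousAt

theorem closedProfile_eq_profile {a w : ℝ} (ha : 1 / 2 < a) (ha1 : a ≠ 1) (hw : 0 < w)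
    (hw1 : w ≤ 1) : closedProfile a w = profile a w := by
  have ha0 : a ≠ 0 := by linarith
  have ha1' : a - 1 ≠ 0 := sub_ne_zero.2 ha1
  -- `w^(2-4a)` times the profile; the tail integral then enters without a weight
  let Ψ : ℝ → ℝ := fun w => 1 / (8 * a * (a - 1)) *
    (w ^ (2 - 4 * a) * (-1 + 8 * a * (a - 1 / 2) * w - 2 * (a * (a - 1 / 2) ^ 2 / (a - 1)) * w ^ 2 +
      (1 - w) ^ (2 * a)) + tailCoeff a - 2 * a * tailBeta (3 - 4 * a) (2 * a) w)
  have hΨ : ∀ y : ℝ, 0 < y → closedProfile a y = y ^ (4 * a - 2) * Ψ y := by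
    intro y hy
    have e : y ^ (4 * a - 2) * y ^ (2 - 4 * a) = 1 := by
      rw [← Real.rpow_add hy]; ring_nf; simp
    simp only [Ψ, closedProfile]
    linear_combination (-1 / (8 * a * (a - 1)) * (-1 + 8 * a * (a - 1 / 2) * y -
      2 * (a * (a - 1 / 2) ^ 2 / (a - 1)) * y ^ 2 + (1 - y) ^ (2 * a))) * e
  have hderiv : ∀ y ∈ Set.uIcc w 1, HasDerivAt Ψ (y ^ (1 - 4 * a) * profileSource a y) y := by
    intro y hy
    rw [Set.uIcc_of_le hw1] at hy
    have hy0 : 0 < y := lt_of_lt_of_le hw hy.1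
    have d1 := Real.hasDerivAt_rpow_const (x := y) (p := 2 - 4 * a) (Or.inl hy0.ne')
    have d2 := hasDerivAt_one_sub_rpow ha y
    have d3 := hasDerivAt_tailBeta (3 - 4 * a) (c := 2 * a) (by linarith) hy0
    have d4 : HasDerivAt (fun w : ℝ => -1 + 8 * a * (a - 1 / 2) * w -
        2 * (a * (a - 1 / 2) ^ 2 / (a - 1)) * w ^ 2)
        (8 * a * (a - 1 / 2) - 2 * (a * (a - 1 / 2) ^ 2 / (a - 1)) * (2 * y)) y := by
      have p1 := ((hasDerivAt_id y).const_mul (8 * a * (a - 1 / 2))).const_add (-1)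
      have p2 := (hasDerivAt_pow 2 y).const_mul (2 * (a * (a - 1 / 2) ^ 2 / (a - 1)))
      refine (p1.sub p2).congr_deriv ?_
      simp
    have d := ((((d1.mul (d4.add d2)).add_const (tailCoeff a)).sub
      (d3.const_mul (2 * a))).const_mul (1 / (8 * a * (a - 1))))
    refine d.congr_deriv ?_
    have r1 : y ^ (2 - 4 * a) = y * y ^ (1 - 4 * a) := by
      rw [show 2 - 4 * a = 1 + (1 - 4 * a) by ring, Real.rpow_add hy0, Real.rpow_one]
    have r2 : y ^ (2 - 4 * a - 1) = y ^ (1 - 4 * a) := by ring_nf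
    have r3 : y ^ (3 - 4 * a - 1) = y * y ^ (1 - 4 * a) := by rw [← r1]; ring_nf
    simp only [Pi.add_apply]
    rw [r2, r3, r1, profileSource, if_neg ha1, sourceNumer]
    field_simp
    ring
  have hint := intervalIntegral.integral_eq_sub_of_hasDerivAt hderiv
    (ContinuousOn.intervalIntegrable ((continuousOn_rpow_mul_profileSource ha).mono fun y hy => by
      rw [Set.uIcc_of_le hw1] at hy
      exact lt_of_lt_of_le hw hy.1))
  have hend : profileEnd a = Ψ 1 := by
    rw [profileEnd, if_neg ha1, hΨ 1 one_pos, Real.one_rpow, one_mul]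
  rw [profile, hint, hend, hΨ w hw]
  ring

theorem gammaClosed_eq_profileMean_profile {a ν : ℝ} (ha : 1 / 2 < a) (ha1 : a ≠ 1) (hν : 0 < ν)
    (k : ℕ) : gammaClosed a ν k = profileMean a (xi a ν) k (profile a) := by
  rw [gammaClosed_eq_profileMean ha ha1 hν, profileMean, profileMean]
  congr 1
  refine setIntegral_congr_fun measurableSet_Ioi fun v hv => ?_
  rw [closedProfile_eq_profile ha ha1 (inv_pos.2 (lt_trans one_pos hv))
    (inv_le_one_of_one_le₀ (Set.mem_Ioi.1 hv).le)]

/-- A bounded source gives a bounded profile. -/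
lemma abs_profile_le {a C : ℝ} (ha : 1 / 2 < a)
    (hC : ∀ x ∈ Set.Ioc (0 : ℝ) 1, |profileSource a x| ≤ C) {w : ℝ} (hw : w ∈ Set.Ioc (0 : ℝ) 1) :
    |profile a w| ≤ |profileEnd a| + C / (4 * a - 2) := by
  have hw0 : 0 < w := hw.1
  have hA : 0 < 4 * a - 2 := by linarith
  have hC0 : 0 ≤ C := (abs_nonneg _).trans (hC 1 (by simp))
  have hn0 : (0 : ℝ) ∉ Set.uIcc w 1 := by
    rw [Set.uIcc_of_le hw.2]; exact fun h => absurd h.1 (by linarith)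
  have hI : |∫ x in w..1, x ^ (1 - 4 * a) * profileSource a x| ≤
      C * ((w ^ (2 - 4 * a) - 1) / (4 * a - 2)) := by
    have h1 : ‖∫ x in w..1, x ^ (1 - 4 * a) * profileSource a x‖ ≤
        ∫ x in w..1, C * x ^ (1 - 4 * a) := by
      refine intervalIntegral.norm_integral_le_of_norm_le hw.2 (Eventually.of_forall ?_)
        ((intervalIntegral.intervalIntegrable_rpow (Or.inr hn0)).const_mul _)
      intro x hx
      have hx0 : 0 < x := hw0.trans hx.1
      rw [norm_mul, Real.norm_of_nonneg (by positivity), mul_comm C]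
      gcongr
      exact hC x ⟨hx0, hx.2⟩
    rw [intervalIntegral.integral_const_mul, integral_rpow (Or.inr ⟨by linarith, hn0⟩),
      Real.one_rpow] at h1
    refine h1.trans_eq ?_
    have e : 1 - 4 * a + 1 = -(4 * a - 2) := by ring
    rw [e, show 2 - 4 * a = -(4 * a - 2) by ring]
    field_simp
    ring
  have hwA : w ^ (4 * a - 2) ≤ 1 := Real.rpow_le_one hw0.le hw.2 hA.le
  have e : w ^ (4 * a - 2) * w ^ (2 - 4 * a) = 1 := by
    rw [← Real.rpow_add hw0]; ring_nf; simp
  have hp := Real.rpow_pos_of_pos hw0 (4 * a - 2)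
  rw [profile, abs_mul, abs_of_pos hp]
  calc _ ≤ w ^ (4 * a - 2) * (|profileEnd a| + C * ((w ^ (2 - 4 * a) - 1) / (4 * a - 2))) := by
        gcongr
        exact (abs_sub _ _).trans (by gcongr)
    _ = w ^ (4 * a - 2) * |profileEnd a| + C / (4 * a - 2) *
        (w ^ (4 * a - 2) * w ^ (2 - 4 * a) - w ^ (4 * a - 2)) := by ring
    _ ≤ 1 * |profileEnd a| + C / (4 * a - 2) * 1 := by
        gcongr
        rw [e]; linarith
    _ = _ := by ring

lemma exists_abs_profile_le {a : ℝ} (ha : 1 / 2 < a) :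
    ∃ C, ∀ w ∈ Set.Ioc (0 : ℝ) 1, |profile a w| ≤ C := by
  obtain ⟨C, hC⟩ := (isCompact_Icc (a := (0 : ℝ)) (b := 1)).exists_bound_of_continuousOn
    (continuous_profileSource ha).continuousOn
  exact ⟨_, fun w hw => abs_profile_le ha (fun x hx => hC x (Set.Ioc_subset_Icc_self hx)) hw⟩

/-! ### The limit `a → 1` -/

lemma hasDerivAt_sourceNumer {x : ℝ} (hx : x < 1) (a : ℝ) :
    HasDerivAt (sourceNumer x) (sourceNumerDeriv x a) a := by
  have hx' : 0 < 1 - x := by linarith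
  have h1 := ((hasDerivAt_id a).const_mul 2).const_rpow hx'
  have h2 : HasDerivAt (fun a : ℝ => 2 * a * (4 * a - 3)) (16 * a - 6) a := by
    have := ((hasDerivAt_id a).const_mul 2).mul (((hasDerivAt_id a).const_mul 4).sub_const 3)
    refine this.congr_deriv ?_
    simp; ring
  have h3 : HasDerivAt (fun a : ℝ => a * (2 * a - 1)) (4 * a - 1) a := by
    have := (hasDerivAt_id a).mul (((hasDerivAt_id a).const_mul 2).sub_const 1)
    refine this.congr_deriv ?_
    simp; ring
  have h := ((h1.const_sub 1).sub (h2.mul_const x)).add (h3.mul_const (x ^ 2))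
  refine h.congr_deriv ?_
  simp only [sourceNumerDeriv, id_eq, mul_one]
  ring

lemma sourceNumer_one (x : ℝ) : sourceNumer x 1 = 0 := by
  unfold sourceNumer
  rw [mul_one, show (2 : ℝ) = ((2 : ℕ) : ℝ) by norm_num, Real.rpow_natCast]
  push_cast
  ring

lemma tendsto_profileSource {x : ℝ} (hx : x < 1) :
    Tendsto (fun a => profileSource a x) (𝓝[≠] 1) (𝓝 (profileSource 1 x)) := by
  have h1 := (hasDerivAt_sourceNumer hx 1).tendsto_slope
  have h2 : Tendsto (fun a : ℝ => (2 * a - 1) / (4 * a)) (𝓝[≠] 1) (𝓝 (1 / 4)) := by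
    have : ContinuousAt (fun a : ℝ => (2 * a - 1) / (4 * a)) 1 := by
      refine ContinuousAt.div (by fun_prop) (by fun_prop) (by norm_num)
    have h := this.tendsto.mono_left (nhdsWithin_le_nhds (s := {1}ᶜ))
    norm_num at h
    convert h using 2
  have h3 := h2.mul h1
  rw [profileSource, if_pos rfl]
  refine h3.congr' ?_
  filter_upwards [self_mem_nhdsWithin] with a ha
  rw [profileSource, if_neg (Set.mem_compl_singleton_iff.1 ha), slope_def_field,
    sourceNumer_one, sub_zero, div_mul_div_comm]
  ring

lemma abs_sourceNumerDeriv_le {x a : ℝ} (hx : x ∈ Set.Ioc (0 : ℝ) 1) (ha : |a - 1| ≤ 1 / 4) :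
    |sourceNumerDeriv x a| ≤ 20 := by
  obtain ⟨ha1, ha2⟩ := abs_le.1 ha
  have h1 : |Real.log (1 - x) * (1 - x) ^ (2 * a)| ≤ 1 := by
    rcases eq_or_lt_of_le hx.2 with rfl | hx1
    · simp
    · have hx0 : 0 < 1 - x := by linarith
      have hlt := Real.abs_log_mul_self_lt (1 - x) hx0 (by linarith [hx.1])
      have hp : (1 - x) ^ (2 * a) ≤ 1 - x := by
        calc (1 - x) ^ (2 * a) ≤ (1 - x) ^ (1 : ℝ) :=
              Real.rpow_le_rpow_of_exponent_ge hx0 (by linarith [hx.1]) (by linarith)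
          _ = _ := Real.rpow_one _
      rw [abs_mul, abs_of_pos (Real.rpow_pos_of_pos hx0 _)]
      rw [abs_mul, abs_of_pos hx0] at hlt
      exact (mul_le_mul_of_nonneg_left hp (abs_nonneg _)).trans hlt.le
  obtain ⟨h2, h3⟩ := abs_le.1 h1
  have hx2 : x ^ 2 ≤ 1 := pow_le_one₀ hx.1.le hx.2
  have h4 : (16 * a - 6) * x ≤ 14 := by nlinarith [hx.1, hx.2]
  have h5 : 0 ≤ (16 * a - 6) * x := by nlinarith [hx.1]
  have h6 : (4 * a - 1) * x ^ 2 ≤ 4 := by nlinarith [hx.1, sq_nonneg x]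
  have h7 : 0 ≤ (4 * a - 1) * x ^ 2 := by nlinarith [sq_nonneg x]
  rw [sourceNumerDeriv, abs_le]
  constructor <;> linarith

lemma abs_profileSource_le {x a : ℝ} (hx : x ∈ Set.Ioc (0 : ℝ) 1) (ha : |a - 1| ≤ 1 / 4) :
    |profileSource a x| ≤ 20 := by
  obtain ⟨ha1, ha2⟩ := abs_le.1 ha
  by_cases h1 : a = 1
  · rw [profileSource, if_pos h1, abs_mul]
    have := abs_sourceNumerDeriv_le hx (a := 1) (by norm_num)
    rw [abs_of_pos (by norm_num : (0 : ℝ) < 1 / 4)]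
    linarith
  · have hd : 0 < |a - 1| := abs_pos.2 (sub_ne_zero.2 h1)
    have hN : |sourceNumer x a| ≤ 20 * |a - 1| := by
      rcases eq_or_lt_of_le hx.2 with rfl | hx1
      · have e : sourceNumer 1 a = -((6 * a + 1) * (a - 1)) := by
          rw [sourceNumer, sub_self, Real.zero_rpow (by linarith)]; ring
        rw [e, abs_neg, abs_mul]
        gcongr
        rw [abs_le]; constructor <;> linarith
      · have hs : Convex ℝ (Set.Icc (3 / 4 : ℝ) (5 / 4)) := convex_Icc _ _
        have := hs.norm_image_sub_le_of_norm_hasDerivWithin_le (f := sourceNumer x)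
          (f' := sourceNumerDeriv x) (C := 20) (x := 1) (y := a)
          (fun b _ => (hasDerivAt_sourceNumer hx1 b).hasDerivWithinAt)
          (fun b hb => abs_sourceNumerDeriv_le hx
            (abs_le.2 ⟨by linarith [hb.1], by linarith [hb.2]⟩))
          ⟨by norm_num, by norm_num⟩ ⟨by linarith, by linarith⟩
        rwa [sourceNumer_one, sub_zero, Real.norm_eq_abs, Real.norm_eq_abs] at this
    rw [profileSource, if_neg h1, abs_mul, abs_div, abs_mul (4 * a), abs_of_pos (by linarith :
      0 < 2 * a - 1), abs_of_pos (by linarith : 0 < 4 * a), div_mul_eq_mul_div,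
      div_le_iff₀ (mul_pos (by linarith) hd)]
    calc (2 * a - 1) * |sourceNumer x a| ≤ (2 * a - 1) * (20 * |a - 1|) := by gcongr; linarith
      _ ≤ 20 * (4 * a * |a - 1|) := by nlinarith

lemma lowerBeta_at_one : lowerBeta (1 / 2) (1 + 2 * 1) (-2 + 2 * 1) = Real.log 2 - 5 / 8 := by
  have h : ∀ u ∈ Set.uIcc (0 : ℝ) (1 / 2), HasDerivAt
      (fun u : ℝ => -u ^ 2 / 2 - u - Real.log (1 - u))
      (u ^ ((1 : ℝ) + 2 * 1 - 1) * (1 - u) ^ ((-2 : ℝ) + 2 * 1 - 1)) u := by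
    intro u hu
    rw [Set.uIcc_of_le (by norm_num)] at hu
    have h1 : 0 < 1 - u := by linarith [hu.2]
    have d1 := ((hasDerivAt_pow 2 u).neg).div_const 2
    have d2 := ((hasDerivAt_id u).const_sub 1).log h1.ne'
    refine ((d1.sub (hasDerivAt_id u)).sub d2).congr_deriv ?_
    rw [show (1 : ℝ) + 2 * 1 - 1 = ((2 : ℕ) : ℝ) by norm_num,
      show (-2 : ℝ) + 2 * 1 - 1 = -1 by norm_num, Real.rpow_natCast, Real.rpow_neg_one]
    simp only [id_eq]
    field_simp
    ring
  rw [lowerBeta, intervalIntegral.integral_eq_sub_of_hasDerivAt h]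
  · have : Real.log (1 - 1 / 2) = -Real.log 2 := by
      rw [← Real.log_inv]; norm_num
    rw [this]
    norm_num
    ring
  · refine ContinuousOn.intervalIntegrable fun u hu => ?_
    rw [Set.uIcc_of_le (by norm_num)] at hu
    refine ContinuousAt.continuousWithinAt (ContinuousAt.mul
      (Real.continuousAt_rpow_const _ _ (Or.inr (by norm_num))) ?_)
    exact ContinuousAt.rpow_const (by fun_prop) (Or.inl (by linarith [hu.2]))

/-- The incomplete beta function is differentiable in its parameters, by differentiation under the
integral sign. -/
lemma differentiableAt_lowerBeta :
    DifferentiableAt ℝ (fun a : ℝ => lowerBeta (1 / 2) (1 + 2 * a) (-2 + 2 * a)) 1 := by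
  have hcont : ∀ a : ℝ, 1 / 2 < a → ContinuousOn
      (fun u : ℝ => u ^ (1 + 2 * a - 1) * (1 - u) ^ (-2 + 2 * a - 1)) (Set.uIcc 0 (1 / 2)) := by
    intro a ha u hu
    rw [Set.uIcc_of_le (by norm_num)] at hu
    refine ContinuousAt.continuousWithinAt (ContinuousAt.mul
      (Real.continuousAt_rpow_const _ _ (Or.inr (by linarith))) ?_)
    exact ContinuousAt.rpow_const (by fun_prop) (Or.inl (by linarith [hu.2]))
  have hioc : Set.uIoc (0 : ℝ) (1 / 2) = Set.Ioc 0 (1 / 2) := Set.uIoc_of_le (by norm_num)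
  have h := intervalIntegral.hasDerivAt_integral_of_dominated_loc_of_deriv_le (μ := volume)
    (a := 0) (b := 1 / 2) (x₀ := (1 : ℝ)) (s := Set.Ioo (1 / 2) 2) (bound := fun _ => 48)
    (F := fun a u : ℝ => u ^ (1 + 2 * a - 1) * (1 - u) ^ (-2 + 2 * a - 1))
    (F' := fun a u : ℝ => u ^ (1 + 2 * a - 1) * (1 - u) ^ (-2 + 2 * a - 1) *
      (2 * Real.log u + 2 * Real.log (1 - u)))
    (Ioo_mem_nhds (by norm_num) (by norm_num)) ?_ ?_ ?_ ?_ ?_ ?_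
  · exact h.2.differentiableAt
  · filter_upwards [Ioi_mem_nhds (show (1 / 2 : ℝ) < 1 by norm_num)] with a ha
    rw [hioc]
    exact ((hcont a ha).mono (by
      rw [Set.uIcc_of_le (by norm_num)]; exact Set.Ioc_subset_Icc_self)).aestronglyMeasurable
        measurableSet_Ioc
  · exact (hcont 1 (by norm_num)).intervalIntegrable
  · rw [hioc]
    refine ContinuousOn.aestronglyMeasurable (ContinuousOn.mul ((hcont 1 (by norm_num)).mono (by
      rw [Set.uIcc_of_le (by norm_num)]; exact Set.Ioc_subset_Icc_self)) ?_) measurableSet_Ioc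
    intro u hu
    refine ContinuousAt.continuousWithinAt (ContinuousAt.add ?_ ?_)
    · exact continuousAt_const.mul (Real.continuousAt_log hu.1.ne')
    · exact continuousAt_const.mul (ContinuousAt.log (by fun_prop) (by linarith [hu.2]))
  · refine Eventually.of_forall fun u hu a ha => ?_
    rw [hioc] at hu
    have hu0 : 0 < u := hu.1
    have h1 : (1 / 2 : ℝ) ≤ 1 - u := by linarith [hu.2]
    have h1' : 0 < 1 - u := by linarith
    have l1 := Real.abs_log_mul_self_lt u hu0 (by linarith)
    have l2 := Real.abs_log_mul_self_lt (1 - u) h1' (by linarith)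
    rw [abs_mul, abs_of_pos hu0] at l1
    rw [abs_mul, abs_of_pos h1'] at l2
    have b1 : u ^ (1 + 2 * a - 1) ≤ u := by
      calc u ^ (1 + 2 * a - 1) ≤ u ^ (1 : ℝ) :=
            Real.rpow_le_rpow_of_exponent_ge hu0 (by linarith) (by linarith [ha.1])
        _ = u := Real.rpow_one u
    have b2 : (1 - u) ^ (-2 + 2 * a - 1) ≤ 8 := by
      calc (1 - u) ^ (-2 + 2 * a - 1) ≤ (1 - u) ^ (-3 : ℝ) :=
            Real.rpow_le_rpow_of_exponent_ge h1' (by linarith) (by linarith [ha.1])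
        _ ≤ (1 / 2 : ℝ) ^ (-3 : ℝ) := Real.rpow_le_rpow_of_nonpos (by norm_num) h1 (by norm_num)
        _ = 8 := by
          rw [Real.rpow_neg (by norm_num), show (3 : ℝ) = ((3 : ℕ) : ℝ) by norm_num,
            Real.rpow_natCast]
          norm_num
    have n1 : |2 * Real.log u + 2 * Real.log (1 - u)| ≤
        2 * |Real.log u| + 2 * |Real.log (1 - u)| := by
      refine (abs_add_le _ _).trans_eq ?_
      rw [abs_mul, abs_mul, abs_two]
    have hp := Real.rpow_nonneg hu0.le (1 + 2 * a - 1)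
    have hq := Real.rpow_nonneg h1'.le (-2 + 2 * a - 1)
    have l3 : u * |Real.log (1 - u)| ≤ 1 := by
      nlinarith [abs_nonneg (Real.log (1 - u)), hu.2]
    rw [norm_mul, norm_mul, Real.norm_of_nonneg hp, Real.norm_of_nonneg hq, Real.norm_eq_abs]
    calc _ ≤ u * 8 * (2 * |Real.log u| + 2 * |Real.log (1 - u)|) := by gcongr
      _ = 16 * (|Real.log u| * u + u * |Real.log (1 - u)|) := by ring
      _ ≤ 48 := by linarith
  · exact intervalIntegrable_const
  · refine Eventually.of_forall fun u hu a ha => ?_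
    rw [hioc] at hu
    have h1' : 0 < 1 - u := by linarith [hu.2]
    have d1 : HasDerivAt (fun a : ℝ => 1 + 2 * a - 1) 2 a := by
      simpa using (((hasDerivAt_id a).const_mul 2).const_add 1).sub_const 1
    have d2 : HasDerivAt (fun a : ℝ => -2 + 2 * a - 1) 2 a := by
      simpa using (((hasDerivAt_id a).const_mul 2).const_add (-2)).sub_const 1
    refine ((d1.const_rpow hu.1).mul (d2.const_rpow h1')).congr_deriv ?_
    ring

/-- At `w = 1` the numerator over `(a - 1)²` has a double zero at `a = 1`: its value and its first
derivative vanish, because the incomplete beta function equals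
`log 2 - 5/8` at `a = 1`. -/
lemma exists_tendsto_closedProfile_one :
    ∃ L, Tendsto (fun a => closedProfile a 1) (𝓝[≠] 1) (𝓝 L) := by
  let B : ℝ → ℝ := fun a => lowerBeta (1 / 2) (1 + 2 * a) (-2 + 2 * a)
  let P : ℝ → ℝ := fun a => (a - 1) * (8 * a ^ 2 - 4 * a - 1) - 2 * (a * (a - 1 / 2) ^ 2) +
    4 * ((2 : ℝ) ^ (-4 * a) * (3 * a - 1))
  have hpow : (2 : ℝ) ^ (-4 * (1 : ℝ)) = 1 / 16 := by
    rw [mul_one, Real.rpow_neg (by norm_num), show (4 : ℝ) = ((4 : ℕ) : ℝ) by norm_num,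
      Real.rpow_natCast]
    norm_num
  have hP1 : P 1 = 0 := by
    simp only [P]; rw [hpow]; norm_num
  have hPd : HasDerivAt P (5 / 4 - 2 * Real.log 2) 1 := by
    have q1 : HasDerivAt (fun a : ℝ => (a - 1) * (8 * a ^ 2 - 4 * a - 1)) 3 1 := by
      have := ((hasDerivAt_id (1 : ℝ)).sub_const 1).mul
        ((((hasDerivAt_pow 2 (1 : ℝ)).const_mul 8).sub
          ((hasDerivAt_id (1 : ℝ)).const_mul 4)).sub_const 1)
      refine this.congr_deriv ?_
      norm_num
    have q2 : HasDerivAt (fun a : ℝ => 2 * (a * (a - 1 / 2) ^ 2)) (5 / 2) 1 := by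
      have := ((hasDerivAt_id (1 : ℝ)).mul
        (((hasDerivAt_id (1 : ℝ)).sub_const (1 / 2)).pow 2)).const_mul 2
      refine this.congr_deriv ?_
      norm_num
    have q3 : HasDerivAt (fun a : ℝ => 4 * ((2 : ℝ) ^ (-4 * a) * (3 * a - 1)))
        (3 / 4 - 2 * Real.log 2) 1 := by
      have := ((((hasDerivAt_id (1 : ℝ)).const_mul (-4)).const_rpow (two_pos (α := ℝ))).mul
        (((hasDerivAt_id (1 : ℝ)).const_mul 3).sub_const 1)).const_mul 4
      refine this.congr_deriv ?_
      simp only [id_eq]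
      rw [hpow]
      ring
    refine ((q1.sub q2).add q3).congr_deriv ?_
    ring
  have hPa : AnalyticAt ℝ P 1 := by
    have : AnalyticAt ℝ (fun a : ℝ => (2 : ℝ) ^ (-4 * a)) 1 := by
      have e : (fun a : ℝ => (2 : ℝ) ^ (-4 * a)) = fun a => Real.exp (Real.log 2 * (-4 * a)) := by
        funext a; rw [Real.rpow_def_of_pos two_pos]
      rw [e]
      fun_prop
    fun_prop
  have hQ : DifferentiableAt ℝ (fun a => dslope P 1 a + 2 * (2 * a - 1) * B a) 1 := by
    obtain ⟨p, hp⟩ := hPa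
    have h1 : DifferentiableAt ℝ (dslope P 1) 1 :=
      (hp.has_fpower_series_dslope_fslope).analyticAt.differentiableAt
    exact h1.add (DifferentiableAt.mul (by fun_prop) differentiableAt_lowerBeta)
  have hQ1 : dslope P 1 1 + 2 * (2 * 1 - 1) * B 1 = 0 := by
    rw [dslope_same, hPd.deriv]
    simp only [B]
    rw [lowerBeta_at_one]
    ring
  have hs := hQ.hasDerivAt.tendsto_slope
  have h8 : Tendsto (fun a : ℝ => 1 / (8 * a)) (𝓝[≠] 1) (𝓝 (1 / (8 * 1))) :=
    (ContinuousAt.div (f := fun _ : ℝ => (1 : ℝ)) (g := fun a : ℝ => 8 * a) (by fun_prop)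
      (by fun_prop) (by norm_num)).tendsto.mono_left nhdsWithin_le_nhds
  refine ⟨_, (h8.mul hs).congr' ?_⟩
  filter_upwards [self_mem_nhdsWithin,
    nhdsWithin_le_nhds (Ioi_mem_nhds (show (1 / 2 : ℝ) < 1 by norm_num))] with a ha ha'
  have ha2 : (1 / 2 : ℝ) < a := ha'
  have ha1 : a - 1 ≠ 0 := sub_ne_zero.2 ha
  have ha0 : a ≠ 0 := by linarith
  rw [slope_def_field, hQ1, sub_zero, dslope_of_ne _ ha, slope_def_field, hP1, sub_zero,
    closedProfile, tailBeta_one, sub_self, Real.zero_rpow (by linarith), Real.one_rpow, tailCoeff]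
  simp only [P, B]
  field_simp
  ring

lemma tendsto_profileEnd : Tendsto profileEnd (𝓝[≠] 1) (𝓝 (profileEnd 1)) := by
  have h := tendsto_nhds_limUnder exists_tendsto_closedProfile_one
  have e : profileEnd 1 = limUnder (𝓝[≠] (1 : ℝ)) (fun a => closedProfile a 1) := by
    rw [profileEnd, if_pos rfl]
  rw [e]
  refine h.congr' ?_
  filter_upwards [self_mem_nhdsWithin] with a ha
  rw [profileEnd, if_neg (Set.mem_compl_singleton_iff.1 ha)]

lemma eventually_near_one : ∀ᶠ a : ℝ in 𝓝[≠] 1, |a - 1| < 1 / 4 :=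
  by
  have := Metric.ball_mem_nhds (1 : ℝ) (show (0 : ℝ) < 1 / 4 by norm_num)
  filter_upwards [nhdsWithin_le_nhds this] with a ha
  rwa [Metric.mem_ball, Real.dist_eq] at ha

lemma tendsto_profile {w : ℝ} (hw : w ∈ Set.Ioc (0 : ℝ) 1) :
    Tendsto (fun a => profile a w) (𝓝[≠] 1) (𝓝 (profile 1 w)) := by
  have hw0 : 0 < w := hw.1
  have hpow : ∀ x : ℝ, 0 < x → ∀ c d : ℝ, Tendsto (fun a : ℝ => x ^ (c * a + d)) (𝓝[≠] 1)
      (𝓝 (x ^ (c * 1 + d))) := fun x hx c d =>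
    (ContinuousAt.rpow (f := fun _ : ℝ => x) (g := fun a : ℝ => c * a + d) continuousAt_const
      (by fun_prop) (Or.inl hx.ne')).tendsto.mono_left nhdsWithin_le_nhds
  have h1 : Tendsto (fun a : ℝ => w ^ (4 * a - 2)) (𝓝[≠] 1) (𝓝 (w ^ (4 * (1 : ℝ) - 2))) := by
    simpa only [sub_eq_add_neg] using hpow w hw0 4 (-2)
  refine h1.mul (tendsto_profileEnd.sub ?_)
  have hsub : Set.uIoc w 1 = Set.Ioc w 1 := Set.uIoc_of_le hw.2
  refine intervalIntegral.tendsto_integral_filter_of_dominated_convergence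
    (fun _ => w ^ (-4 : ℝ) * 20) ?_ ?_ intervalIntegrable_const ?_
  · filter_upwards [eventually_near_one] with a ha
    have := (abs_lt.1 ha).1
    rw [hsub]
    exact ((continuousOn_rpow_mul_profileSource (by linarith)).mono fun x hx =>
      hw0.trans hx.1).aestronglyMeasurable measurableSet_Ioc
  · filter_upwards [eventually_near_one] with a ha
    obtain ⟨ha1, ha2⟩ := abs_lt.1 ha
    refine Eventually.of_forall fun x hx => ?_
    rw [hsub] at hx
    have hx0 : 0 < x := hw0.trans hx.1
    rw [norm_mul, Real.norm_of_nonneg (by positivity)]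
    gcongr
    · calc x ^ (1 - 4 * a) ≤ w ^ (1 - 4 * a) :=
            Real.rpow_le_rpow_of_nonpos hw0 hx.1.le (by linarith)
        _ ≤ w ^ (-4 : ℝ) := Real.rpow_le_rpow_of_exponent_ge hw0 hw.2 (by linarith)
    · exact abs_profileSource_le ⟨hx0, hx.2⟩ ha.le
  · have hne : ∀ᵐ x : ℝ, x ≠ 1 := by simp [ae_iff, measure_singleton]
    filter_upwards [hne] with x hx1 hx
    rw [hsub] at hx
    have hx0 : 0 < x := hw0.trans hx.1
    refine Tendsto.mul ?_ (tendsto_profileSource (lt_of_le_of_ne hx.2 hx1))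
    have := hpow x hx0 (-4) 1
    have e : ∀ a : ℝ, -4 * a + 1 = 1 - 4 * a := fun a => by ring
    simpa only [e] using this

/-- Dominated convergence, both in the profile and in the weight. -/
theorem tendsto_profileMean {ν : ℝ} (hν : 0 < ν) (k : ℕ) :
    Tendsto (fun a => profileMean a (xi a ν) k (profile a)) (𝓝[≠] 1)
      (𝓝 (profileMean 1 (xi 1 ν) k (profile 1))) := by
  have hx1 := xi_pos (α := 1) (by norm_num) hν
  have hxc : Tendsto (fun a => xi a ν) (𝓝[≠] 1) (𝓝 (xi 1 ν)) := by
    refine (ContinuousAt.div (f := fun a : ℝ => 4 * a * ν) (g := fun a => Real.pi * (2 * a - 1))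
      (by fun_prop) (by fun_prop) ?_).tendsto.mono_left nhdsWithin_le_nhds
    have := Real.pi_pos.ne'
    norm_num
  have hxev : ∀ᶠ a in 𝓝[≠] 1, xi 1 ν / 2 < xi a ν :=
    hxc.eventually (Ioi_mem_nhds (half_lt_self hx1))
  have hwt : ∀ v ∈ Set.Ioi (1 : ℝ), Tendsto (fun a : ℝ => v ^ ((k : ℝ) - 2 * a - 1) *
      Real.exp (-(xi a ν * v))) (𝓝[≠] 1)
      (𝓝 (v ^ ((k : ℝ) - 2 * 1 - 1) * Real.exp (-(xi 1 ν * v)))) := by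
    intro v hv
    have hv0 : (0 : ℝ) < v := lt_trans one_pos hv
    refine Tendsto.mul ?_ ?_
    · exact (ContinuousAt.rpow (f := fun _ : ℝ => v) (g := fun a : ℝ => (k : ℝ) - 2 * a - 1)
        continuousAt_const (by fun_prop) (Or.inl hv0.ne')).tendsto.mono_left nhdsWithin_le_nhds
    · exact (Real.continuous_exp.tendsto _).comp ((hxc.mul_const v).neg)
  have hwb : ∀ᶠ a in 𝓝[≠] 1, ∀ v ∈ Set.Ioi (1 : ℝ),
      v ^ ((k : ℝ) - 2 * a - 1) * Real.exp (-(xi a ν * v)) ≤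
        v ^ (k : ℝ) * Real.exp (-(xi 1 ν / 2 * v)) := by
    filter_upwards [hxev, eventually_near_one] with a hxa ha v hv
    have hv1 : (1 : ℝ) < v := hv
    have hv0 : (0 : ℝ) < v := by linarith
    have := (abs_lt.1 ha).1
    gcongr
    · exact hv1.le
    · linarith
  have hwm : ∀ a : ℝ, AEStronglyMeasurable (fun v : ℝ => v ^ ((k : ℝ) - 2 * a - 1) *
      Real.exp (-(xi a ν * v))) (volume.restrict (Set.Ioi 1)) := fun a =>
    ContinuousOn.aestronglyMeasurable (ContinuousOn.mul (fun v hv =>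
      (Real.continuousAt_rpow_const _ _ (Or.inl (lt_trans one_pos hv).ne')).continuousWithinAt)
      (by fun_prop)) measurableSet_Ioi
  obtain ⟨M, hM⟩ : ∃ M, ∀ᶠ a in 𝓝[≠] 1, ∀ w ∈ Set.Ioc (0 : ℝ) 1, |profile a w| ≤ M := by
    refine ⟨|profileEnd 1| + 1 + 20, ?_⟩
    filter_upwards [eventually_near_one, tendsto_profileEnd.abs.eventually
      (Iio_mem_nhds (lt_add_one |profileEnd 1|))] with a ha hK w hw
    have := (abs_lt.1 ha).1
    refine (abs_profile_le (C := 20) (by linarith)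
      (fun x hx => abs_profileSource_le hx ha.le) hw).trans ?_
    have h2 : 20 / (4 * a - 2) ≤ 20 := by
      rw [div_le_iff₀ (by linarith)]; linarith
    have h3 : |profileEnd a| < |profileEnd 1| + 1 := hK
    linarith
  have hbi := integrableOn_rpow_mul_exp_Ioi_one (half_pos hx1) (k : ℝ)
  refine Tendsto.div ?_ ?_ (expMoment_pos hx1 _).ne'
  · refine tendsto_integral_filter_of_dominated_convergence
      (fun v => v ^ (k : ℝ) * Real.exp (-(xi 1 ν / 2 * v)) * M) ?_ ?_ (hbi.mul_const M) ?_
    · filter_upwards [eventually_near_one] with a ha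
      have := (abs_lt.1 ha).1
      refine (hwm a).mul (ContinuousOn.aestronglyMeasurable ?_ measurableSet_Ioi)
      exact (continuousOn_profile (by linarith)).comp
        (continuousOn_inv₀.mono fun _ hv => (lt_trans one_pos hv).ne')
        fun v hv => Set.mem_Ioi.2 (inv_pos.2 (lt_trans one_pos hv))
    · filter_upwards [hwb, hM] with a h1 h2
      refine (ae_restrict_mem measurableSet_Ioi).mono fun v hv => ?_
      have hv0 : (0 : ℝ) < v := lt_trans one_pos hv
      rw [norm_mul, Real.norm_of_nonneg (by positivity)]
      exact mul_le_mul (h1 v hv) (h2 _ ⟨inv_pos.2 hv0, inv_le_one_of_one_le₀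
        (Set.mem_Ioi.1 hv).le⟩) (norm_nonneg _) (by positivity)
    · refine (ae_restrict_mem measurableSet_Ioi).mono fun v hv => ?_
      exact (hwt v hv).mul (tendsto_profile
        ⟨inv_pos.2 (lt_trans one_pos hv), inv_le_one_of_one_le₀ (Set.mem_Ioi.1 hv).le⟩)
  · refine tendsto_integral_filter_of_dominated_convergence
      (fun v => v ^ (k : ℝ) * Real.exp (-(xi 1 ν / 2 * v))) (Eventually.of_forall hwm) ?_ hbi ?_
    · filter_upwards [hwb] with a h1
      refine (ae_restrict_mem measurableSet_Ioi).mono fun v hv => ?_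
      have hv0 : (0 : ℝ) < v := lt_trans one_pos hv
      rw [Real.norm_of_nonneg (by positivity)]
      exact h1 v hv
    · exact (ae_restrict_mem measurableSet_Ioi).mono hwt

theorem tendsto_gammaClosed {ν : ℝ} (hν : 0 < ν) (k : ℕ) :
    Tendsto (fun a => gammaClosed a ν k) (𝓝[≠] 1)
      (𝓝 (profileMean 1 (xi 1 ν) k (profile 1))) := by
  refine (tendsto_profileMean hν k).congr' ?_
  filter_upwards [self_mem_nhdsWithin, eventually_near_one] with a ha ha'
  have := (abs_lt.1 ha').1
  rw [gammaClosed_eq_profileMean_profile (by linarith) ha hν]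

theorem gammaFun_eq_profileMean {α ν : ℝ} (hα : 1 / 2 < α) (hν : 0 < ν) (k : ℕ) :
    gammaFun α ν k = profileMean α (xi α ν) k (profile α) := by
  rw [gammaFun]
  split_ifs with h
  · subst h
    exact (tendsto_gammaClosed hν k).limUnder_eq
  · exact gammaClosed_eq_profileMean_profile hα h hν k

/-! ### Transfer of profile asymptotics to the means -/

lemma profileMean_rpow {x : ℝ} (a q : ℝ) (k : ℕ) :
    profileMean a x k (fun w => w ^ q) =
      expMoment x (k - 2 * a - 1 - q) / expMoment x (k - 2 * a - 1) := by
  rw [profileMean]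
  congr 1
  refine setIntegral_congr_fun measurableSet_Ioi fun v hv => ?_
  have hv0 : (0 : ℝ) < v := lt_trans one_pos hv
  rw [Real.rpow_sub hv0 _ q, Real.inv_rpow hv0.le]
  ring

lemma integrableOn_weight_mul_rpow {x : ℝ} (hx : 0 < x) (s q : ℝ) :
    IntegrableOn (fun v : ℝ => v ^ s * Real.exp (-(x * v)) * v⁻¹ ^ q) (Set.Ioi 1) := by
  refine (integrableOn_rpow_mul_exp_Ioi_one hx (s - q)).congr
    ((ae_restrict_mem measurableSet_Ioi).mono fun v hv => ?_)
  have hv0 : (0 : ℝ) < v := lt_trans one_pos hv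
  beta_reduce
  rw [Real.rpow_sub hv0, Real.inv_rpow hv0.le]
  ring

lemma tendsto_profileMean_rpow {x : ℝ} (hx : 0 < x) (a q : ℝ) :
    Tendsto (fun k : ℕ => profileMean a x k (fun w => w ^ q) * (k : ℝ) ^ q) atTop
      (𝓝 (x ^ q)) := by
  refine (tendsto_expMoment_ratio hx (-(2 * a + 1)) q).congr fun k => ?_
  rw [profileMean_rpow]
  ring_nf

/-- If `f` is within `A w^p + B w^q + D w^r` of `c w^t`, then so are the means. -/
lemma abs_profileMean_sub_le {x : ℝ} (hx : 0 < x) (a : ℝ) (k : ℕ) {f : ℝ → ℝ} {M : ℝ}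
    (hf : ContinuousOn f (Set.Ioc 0 1)) (hM : ∀ w ∈ Set.Ioc (0 : ℝ) 1, |f w| ≤ M)
    {c t A p B q D r : ℝ}
    (h : ∀ w ∈ Set.Ioc (0 : ℝ) 1, |f w - c * w ^ t| ≤ A * w ^ p + B * w ^ q + D * w ^ r) :
    |profileMean a x k f - c * profileMean a x k (fun w => w ^ t)| ≤
      A * profileMean a x k (fun w => w ^ p) + B * profileMean a x k (fun w => w ^ q) +
        D * profileMean a x k (fun w => w ^ r) := by
  have hm := expMoment_pos hx ((k : ℝ) - 2 * a - 1)
  have i0 := integrableOn_weight_mul hx ((k : ℝ) - 2 * a - 1) hf hM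
  have i := fun q => integrableOn_weight_mul_rpow hx ((k : ℝ) - 2 * a - 1) q
  simp only [profileMean, ← mul_div_assoc, ← add_div, ← sub_div]
  rw [abs_div, abs_of_pos hm, div_le_div_iff_of_pos_right hm, ← integral_const_mul c,
    ← integral_const_mul A, ← integral_const_mul B, ← integral_const_mul D,
    ← integral_sub i0 ((i t).const_mul c), ← integral_add ((i p).const_mul A) ((i q).const_mul B),
    ← integral_add _ ((i r).const_mul D)]
  · rw [← Real.norm_eq_abs]
    refine norm_integral_le_of_norm_le
      ((((i p).const_mul A).add ((i q).const_mul B)).add ((i r).const_mul D)) ?_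
    refine (ae_restrict_mem measurableSet_Ioi).mono fun v hv => ?_
    have hv0 : (0 : ℝ) < v := lt_trans one_pos hv
    have hw := h v⁻¹ ⟨inv_pos.2 hv0, inv_le_one_of_one_le₀ (Set.mem_Ioi.1 hv).le⟩
    have hW : 0 < v ^ ((k : ℝ) - 2 * a - 1) * Real.exp (-(x * v)) := by positivity
    rw [Real.norm_eq_abs]
    calc _ = v ^ ((k : ℝ) - 2 * a - 1) * Real.exp (-(x * v)) * |f v⁻¹ - c * v⁻¹ ^ t| := by
          rw [← abs_of_pos hW, ← abs_mul, abs_of_pos hW]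
          ring_nf
      _ ≤ v ^ ((k : ℝ) - 2 * a - 1) * Real.exp (-(x * v)) *
          (A * v⁻¹ ^ p + B * v⁻¹ ^ q + D * v⁻¹ ^ r) := by gcongr
      _ = _ := by ring
  · exact ((i p).const_mul A).add ((i q).const_mul B)

/-- Away from `w = 0` the error is absorbed by a higher power of `w`, so that an asymptotic relation
at `0` becomes a bound on all of `(0, 1]`. -/
lemma exists_abs_sub_le_of_tendsto {f : ℝ → ℝ} {M c p δ : ℝ}
    (hM : ∀ w ∈ Set.Ioc (0 : ℝ) 1, |f w| ≤ M) (hp : 0 ≤ p) (hδ : 0 < δ)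
    (hf : Tendsto (fun w => f w / w ^ p) (𝓝[>] 0) (𝓝 c)) {ε : ℝ} (hε : 0 < ε) :
    ∃ C, 0 ≤ C ∧ ∀ w ∈ Set.Ioc (0 : ℝ) 1, |f w - c * w ^ p| ≤ ε * w ^ p + C * w ^ (p + δ) := by
  obtain ⟨η, hη, hηε⟩ := mem_nhdsGT_iff_exists_Ioo_subset.1
    (hf.eventually (Metric.ball_mem_nhds c hε))
  have hη0 : (0 : ℝ) < η := hη
  have hM0 : 0 ≤ M := (abs_nonneg _).trans (hM 1 (by simp))
  have hηp := Real.rpow_pos_of_pos hη0 (p + δ)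
  refine ⟨(M + |c|) / η ^ (p + δ), by positivity, fun w hw => ?_⟩
  have hw0 : 0 < w := hw.1
  have hwp := Real.rpow_pos_of_pos hw0 p
  by_cases hlt : w < η
  · have h1 : |f w / w ^ p - c| < ε := by
      simpa [Real.dist_eq] using hηε ⟨hw0, hlt⟩
    have e : f w - c * w ^ p = (f w / w ^ p - c) * w ^ p := by field_simp
    rw [e, abs_mul, abs_of_pos hwp]
    have : 0 ≤ (M + |c|) / η ^ (p + δ) * w ^ (p + δ) := by positivity
    have := mul_le_mul_of_nonneg_right h1.le hwp.le
    linarith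
  · have h1 : η ^ (p + δ) ≤ w ^ (p + δ) :=
      Real.rpow_le_rpow hη0.le (not_lt.1 hlt) (by linarith)
    have h2 : w ^ p ≤ 1 := Real.rpow_le_one hw0.le hw.2 hp
    calc |f w - c * w ^ p| ≤ |f w| + |c * w ^ p| := abs_sub _ _
      _ ≤ M + |c| * 1 := by
        rw [abs_mul, abs_of_pos hwp]
        gcongr
        exact hM w hw
      _ = (M + |c|) / η ^ (p + δ) * η ^ (p + δ) := by field_simp
      _ ≤ (M + |c|) / η ^ (p + δ) * w ^ (p + δ) := by gcongr
      _ ≤ _ := by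
        have : 0 ≤ ε * w ^ p := by positivity
        linarith

theorem tendsto_profileMean_mul_rpow {x : ℝ} (hx : 0 < x) (a : ℝ) {f : ℝ → ℝ} {M c p : ℝ}
    (hf : ContinuousOn f (Set.Ioc 0 1)) (hM : ∀ w ∈ Set.Ioc (0 : ℝ) 1, |f w| ≤ M) (hp : 0 ≤ p)
    (hlim : Tendsto (fun w => f w / w ^ p) (𝓝[>] 0) (𝓝 c)) :
    Tendsto (fun k : ℕ => profileMean a x k f * (k : ℝ) ^ p) atTop (𝓝 (c * x ^ p)) := by
  have hr := tendsto_profileMean_rpow hx a p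
  have ht : Tendsto (fun k : ℕ => profileMean a x k (fun w => w ^ (p + 1)) * (k : ℝ) ^ p) atTop
      (𝓝 0) := by
    have h := (tendsto_profileMean_rpow hx a (p + 1)).mul
      (tendsto_inv_atTop_nhds_zero_nat (𝕜 := ℝ))
    rw [mul_zero] at h
    refine h.congr' ?_
    filter_upwards [eventually_gt_atTop 0] with k hk
    have hk0 : (k : ℝ) ≠ 0 := by exact_mod_cast hk.ne'
    rw [Real.rpow_add_one hk0]
    field_simp
  have hdiff : Tendsto (fun k : ℕ => profileMean a x k f * (k : ℝ) ^ p -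
      c * (profileMean a x k (fun w => w ^ p) * (k : ℝ) ^ p)) atTop (𝓝 0) := by
    rw [Metric.tendsto_atTop']
    intro η hη
    have hxp := Real.rpow_pos_of_pos hx p
    have hε : 0 < η / (2 * (x ^ p + 1)) := by positivity
    obtain ⟨C, hC0, hC⟩ := exists_abs_sub_le_of_tendsto hM hp one_pos hlim hε
    have e1 := hr.eventually (Iio_mem_nhds (lt_add_one (x ^ p)))
    have e2 := (ht.const_mul C).eventually (Iio_mem_nhds (show C * 0 < η / 2 by simpa using hη))
    obtain ⟨N, hN⟩ := eventually_atTop.1 (e1.and e2)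
    refine ⟨N, fun k hk => ?_⟩
    obtain ⟨h1, h2⟩ := hN k (le_of_lt hk)
    have h1' : profileMean a x k (fun w => w ^ p) * (k : ℝ) ^ p < x ^ p + 1 := h1
    have h2' : C * (profileMean a x k (fun w => w ^ (p + 1)) * (k : ℝ) ^ p) < η / 2 := h2
    have hb := abs_profileMean_sub_le hx a k hf hM (c := c) (t := p)
      (A := η / (2 * (x ^ p + 1))) (p := p) (B := C) (q := p + 1) (D := 0) (r := 0)
      (fun w hw => by simpa using hC w hw)
    rw [zero_mul, add_zero] at hb
    have hkp : 0 ≤ (k : ℝ) ^ p := by positivity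
    rw [Real.dist_eq, sub_zero, ← mul_assoc, ← sub_mul, abs_mul, abs_of_nonneg hkp]
    calc _ ≤ (η / (2 * (x ^ p + 1)) * profileMean a x k (fun w => w ^ p) +
          C * profileMean a x k (fun w => w ^ (p + 1))) * (k : ℝ) ^ p := by gcongr
      _ = η / (2 * (x ^ p + 1)) * (profileMean a x k (fun w => w ^ p) * (k : ℝ) ^ p) +
          C * (profileMean a x k (fun w => w ^ (p + 1)) * (k : ℝ) ^ p) := by ring
      _ < η / (2 * (x ^ p + 1)) * (x ^ p + 1) + η / 2 := by gcongr
      _ = η := by field_simp; ring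
  have h := hdiff.add (hr.const_mul c)
  rw [zero_add] at h
  exact h.congr fun k => by ring

/-- The logarithmic case: on the scale of the weight, `log (1/w) = log v` is `log k + O(1)` in mean,
by the tangent inequalities `|log (v / k)| ≤ v / k + k / v`. -/
theorem tendsto_profileMean_log {x : ℝ} (hx : 0 < x) (a : ℝ) {f : ℝ → ℝ} {M C : ℝ}
    (hf : ContinuousOn f (Set.Ioc 0 1)) (hM : ∀ w ∈ Set.Ioc (0 : ℝ) 1, |f w| ≤ M)
    (hlog : ∀ w ∈ Set.Ioc (0 : ℝ) 1, |f w + w * Real.log w| ≤ C * w) :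
    Tendsto (fun k : ℕ => profileMean a x k f * (k / Real.log k)) atTop (𝓝 x) := by
  have h0 := tendsto_profileMean_rpow hx a 0
  have h1 := tendsto_profileMean_rpow hx a 1
  have h2 := tendsto_profileMean_rpow hx a 2
  have hinv : Tendsto (fun k : ℕ => (Real.log k)⁻¹) atTop (𝓝 0) :=
    tendsto_inv_atTop_zero.comp (Real.tendsto_log_atTop.comp tendsto_natCast_atTop_atTop)
  have hsum := (((h1.const_mul C).add h0).add h2).mul hinv
  rw [mul_zero] at hsum
  have hdiff : Tendsto (fun k : ℕ => profileMean a x k f * (k / Real.log k) -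
      profileMean a x k (fun w => w ^ (1 : ℝ)) * (k : ℝ) ^ (1 : ℝ)) atTop (𝓝 0) := by
    refine squeeze_zero_norm' ?_ hsum
    filter_upwards [eventually_gt_atTop 1] with k hk
    have hk1 : (1 : ℝ) < k := by exact_mod_cast hk
    have hk0 : (0 : ℝ) < k := by linarith
    have hl : 0 < Real.log k := Real.log_pos hk1
    have hb := abs_profileMean_sub_le hx a k hf hM (c := Real.log k) (t := 1)
      (A := C) (p := 1) (B := 1 / k) (q := 0) (D := k) (r := 2) (fun w hw => by
        have hw0 : 0 < w := hw.1
        have hkw : 0 < k * w := by positivity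
        have l1 := Real.log_le_sub_one_of_pos hkw
        have l2 := Real.log_le_sub_one_of_pos (inv_pos.2 hkw)
        rw [Real.log_inv] at l2
        rw [Real.log_mul hk0.ne' hw0.ne'] at l1 l2
        have hi : 0 < (k * w)⁻¹ := inv_pos.2 hkw
        have hlogs : |Real.log k + Real.log w| ≤ (k * w)⁻¹ + k * w := by
          rw [abs_le]; constructor <;> linarith
        have e : f w - Real.log k * w ^ (1 : ℝ) =
            (f w + w * Real.log w) - w * (Real.log k + Real.log w) := by
          rw [Real.rpow_one]; ring
        have h3 := hlog w hw
        rw [e]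
        refine (abs_sub _ _).trans ?_
        rw [abs_mul, abs_of_pos hw0, Real.rpow_one, Real.rpow_zero, Real.rpow_two]
        have h4 : w * |Real.log k + Real.log w| ≤ w * ((k * w)⁻¹ + k * w) := by gcongr
        have h5 : w * ((k * w)⁻¹ + k * w) = 1 / k * 1 + k * w ^ 2 := by field_simp
        linarith)
    have e1 : profileMean a x k f * (k / Real.log k) -
        profileMean a x k (fun w => w ^ (1 : ℝ)) * (k : ℝ) ^ (1 : ℝ) =
        (profileMean a x k f - Real.log k * profileMean a x k (fun w => w ^ (1 : ℝ))) *
          (k / Real.log k) := by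
      rw [Real.rpow_one]; field_simp
    rw [e1, norm_mul, Real.norm_of_nonneg (by positivity : 0 ≤ (k : ℝ) / Real.log k),
      Real.norm_eq_abs]
    calc _ ≤ _ := mul_le_mul_of_nonneg_right hb (by positivity)
      _ = _ := by
        rw [Real.rpow_one, Real.rpow_zero, Real.rpow_two]
        field_simp
  have h := hdiff.add h1
  rw [zero_add, Real.rpow_one] at h
  exact h.congr fun k => by ring

/-! ### Asymptotics of the profile at `w = 0` -/

lemma hasDerivAt_profileSource_zero {a : ℝ} (ha : 1 / 2 < a) :
    profileSource a 0 = 0 ∧ HasDerivAt (profileSource a) (-(4 * a - 2)) 0 := by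
  by_cases h1 : a = 1
  · subst h1
    have e : profileSource 1 = fun x => 1 / 4 * sourceNumerDeriv x 1 := by
      funext x; simp [profileSource]
    have d1 : HasDerivAt (fun x : ℝ => Real.log (1 - x) * (1 - x) ^ ((2 : ℝ) * 1)) (-1) 0 := by
      have := (((hasDerivAt_id (0 : ℝ)).const_sub 1).log (by norm_num)).mul
        (hasDerivAt_one_sub_rpow (a := 1) (by norm_num) 0)
      refine this.congr_deriv ?_
      simp
    have d2 := (((d1.const_mul 2).neg.sub ((hasDerivAt_id (0 : ℝ)).const_mul (16 * 1 - 6))).add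
      ((hasDerivAt_pow 2 (0 : ℝ)).const_mul (4 * 1 - 1))).const_mul (1 / 4)
    rw [e]
    constructor
    · simp [sourceNumerDeriv]
    · refine d2.congr_deriv ?_
      norm_num
  · have e : profileSource a = fun x => (2 * a - 1) / (4 * a * (a - 1)) * sourceNumer x a := by
      funext x; simp [profileSource, h1]
    have ha0 : a ≠ 0 := by linarith
    have ha1 : a - 1 ≠ 0 := sub_ne_zero.2 h1
    have d2 := ((((hasDerivAt_one_sub_rpow ha 0).const_sub 1).sub
      ((hasDerivAt_id (0 : ℝ)).const_mul (2 * a * (4 * a - 3)))).add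
      ((hasDerivAt_pow 2 (0 : ℝ)).const_mul (a * (2 * a - 1)))).const_mul
        ((2 * a - 1) / (4 * a * (a - 1)))
    rw [e]
    constructor
    · simp [sourceNumer]
    · refine d2.congr_deriv ?_
      simp
      field_simp
      ring

lemma zero_notMem_uIcc {w : ℝ} (hw : w ∈ Set.Ioc (0 : ℝ) 1) : (0 : ℝ) ∉ Set.uIcc w 1 := by
  rw [Set.uIcc_of_le hw.2]; exact fun h => absurd h.1 (not_le.2 hw.1)

lemma intervalIntegrable_rpow_mul_profileSource {a : ℝ} (ha : 1 / 2 < a) {w : ℝ}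
    (hw : w ∈ Set.Ioc (0 : ℝ) 1) :
    IntervalIntegrable (fun x : ℝ => x ^ (1 - 4 * a) * profileSource a x) volume w 1 :=
  ContinuousOn.intervalIntegrable ((continuousOn_rpow_mul_profileSource ha).mono fun y hy => by
    rw [Set.uIcc_of_le hw.2] at hy
    exact lt_of_lt_of_le hw.1 hy.1)

/-- For `a > 3/4` the integral in the profile diverges at `0` like `w^(3-4a)`, with the coefficient
given by the slope of the source at `0`. -/
lemma tendsto_profile_div_of_gt {a : ℝ} (ha : 3 / 4 < a) :
    Tendsto (fun w => profile a w / w ^ (1 : ℝ)) (𝓝[>] 0) (𝓝 ((4 * a - 2) / (4 * a - 3))) := by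
  have ha2 : 1 / 2 < a := by linarith
  have hβ : 0 < 4 * a - 3 := by linarith
  set β := 4 * a - 3 with hβd
  have hpow : ∀ q : ℝ, 0 < q → Tendsto (fun w : ℝ => w ^ q) (𝓝[>] 0) (𝓝 0) := fun q hq => by
    have := (Real.continuousAt_rpow_const (0 : ℝ) q (Or.inr hq.le)).tendsto
    rw [Real.zero_rpow hq.ne'] at this
    exact this.mono_left nhdsWithin_le_nhds
  obtain ⟨C₀, hC₀⟩ := (isCompact_Icc (a := (0 : ℝ)) (b := 1)).exists_bound_of_continuousOn
    (continuous_profileSource ha2).continuousOn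
  have hE : Tendsto (fun x => profileSource a x / x ^ (1 : ℝ)) (𝓝[>] 0)
      (𝓝 (-(4 * a - 2))) := by
    obtain ⟨h0, hd⟩ := hasDerivAt_profileSource_zero ha2
    have := hd.tendsto_slope.mono_left (nhdsGT_le_nhdsNE 0)
    refine this.congr fun x => ?_
    rw [slope_def_field, h0, sub_zero, sub_zero, Real.rpow_one]
  -- the integral compared with that of the linear part of the source
  have hI : Tendsto (fun w : ℝ => w ^ β * ((∫ x in w..1, x ^ (1 - 4 * a) * profileSource a x) -
      -(4 * a - 2) * ((w ^ (-β) - 1) / β))) (𝓝[>] 0) (𝓝 0) := by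
    rw [Metric.tendsto_nhds]
    intro η hη
    obtain ⟨C, hC0, hC⟩ := exists_abs_sub_le_of_tendsto (f := profileSource a) (M := C₀) (p := 1)
      (δ := β / 2) (fun w hw => hC₀ w (Set.Ioc_subset_Icc_self hw)) zero_le_one (half_pos hβ) hE
      (ε := η * β / 2) (by positivity)
    have hev := ((hpow (β / 2) (half_pos hβ)).const_mul (C / (β / 2))).eventually
      (Iio_mem_nhds (show C / (β / 2) * 0 < η / 2 by simpa using hη))
    filter_upwards [hev, Ioc_mem_nhdsGT one_pos] with w hwC hw
    have hw0 : 0 < w := hw.1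
    have hn0 := zero_notMem_uIcc hw
    have hi : ∀ r : ℝ, IntervalIntegrable (fun x : ℝ => x ^ r) volume w 1 := fun r =>
      intervalIntegral.intervalIntegrable_rpow (Or.inr hn0)
    have hcalc : ∀ r : ℝ, 0 < r → ∫ x in w..1, x ^ (-r - 1) = (w ^ (-r) - 1) / r := by
      intro r hr
      rw [integral_rpow (Or.inr ⟨by linarith, hn0⟩), Real.one_rpow, sub_add_cancel]
      field_simp
      ring
    have hlin : (∫ x in w..1, x ^ (1 - 4 * a) * profileSource a x) -
        -(4 * a - 2) * ((w ^ (-β) - 1) / β) =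
        ∫ x in w..1, (x ^ (1 - 4 * a) * profileSource a x - -(4 * a - 2) * x ^ (-β - 1)) := by
      rw [intervalIntegral.integral_sub (intervalIntegrable_rpow_mul_profileSource ha2 hw)
        ((hi _).const_mul _), intervalIntegral.integral_const_mul, hcalc β hβ]
    have hbound : ‖∫ x in w..1, (x ^ (1 - 4 * a) * profileSource a x -
        -(4 * a - 2) * x ^ (-β - 1))‖ ≤
        ∫ x in w..1, (η * β / 2 * x ^ (-β - 1) + C * x ^ (-(β / 2) - 1)) := by
      refine intervalIntegral.norm_integral_le_of_norm_le hw.2 (Eventually.of_forall ?_)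
        (((hi _).const_mul _).add ((hi _).const_mul _))
      intro x hx
      have hx0 : 0 < x := hw0.trans hx.1
      have h := hC x ⟨hx0, hx.2⟩
      have e1 : x ^ (-β - 1) = x ^ (1 - 4 * a) * x ^ (1 : ℝ) := by
        rw [← Real.rpow_add hx0, hβd]; ring_nf
      have e2 : x ^ (-(β / 2) - 1) = x ^ (1 - 4 * a) * x ^ (1 + β / 2) := by
        rw [← Real.rpow_add hx0, hβd]; ring_nf
      have hp := Real.rpow_pos_of_pos hx0 (1 - 4 * a)
      rw [e1, e2, Real.norm_eq_abs]
      calc _ = x ^ (1 - 4 * a) * |profileSource a x - -(4 * a - 2) * x ^ (1 : ℝ)| := by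
            rw [← abs_of_pos hp, ← abs_mul, abs_of_pos hp]; ring_nf
        _ ≤ x ^ (1 - 4 * a) * (η * β / 2 * x ^ (1 : ℝ) + C * x ^ (1 + β / 2)) := by gcongr
        _ = _ := by ring
    rw [intervalIntegral.integral_add ((hi _).const_mul _) ((hi _).const_mul _),
      intervalIntegral.integral_const_mul, intervalIntegral.integral_const_mul, hcalc β hβ,
      hcalc (β / 2) (half_pos hβ)] at hbound
    have hwβ := Real.rpow_pos_of_pos hw0 β
    have p1 : w ^ β * w ^ (-β) = 1 := by rw [← Real.rpow_add hw0]; simp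
    have p2 : w ^ β * w ^ (-(β / 2)) = w ^ (β / 2) := by rw [← Real.rpow_add hw0]; ring_nf
    have hwC' : C / (β / 2) * w ^ (β / 2) < η / 2 := hwC
    rw [hlin, Real.dist_eq, sub_zero, abs_mul, abs_of_pos hwβ]
    calc _ ≤ w ^ β * (η * β / 2 * ((w ^ (-β) - 1) / β) +
          C * ((w ^ (-(β / 2)) - 1) / (β / 2))) := by
          rw [Real.norm_eq_abs] at hbound; gcongr
      _ = η / 2 * (w ^ β * w ^ (-β) - w ^ β) +
          C / (β / 2) * (w ^ β * w ^ (-(β / 2)) - w ^ β) := by field_simp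
      _ ≤ η / 2 * 1 + C / (β / 2) * w ^ (β / 2) := by
          rw [p1, p2]
          gcongr <;> linarith
      _ < η := by linarith
  have hw := hpow β hβ
  have h := ((hw.mul_const (profileEnd a)).sub hI).add
    (((hw.const_mul (-1)).const_add 1).const_mul ((4 * a - 2) / β))
  simp only [zero_mul, sub_zero, mul_zero, add_zero, mul_one, zero_add] at h
  refine h.congr' ?_
  filter_upwards [self_mem_nhdsWithin] with w hw
  have hw0 : 0 < w := hw
  have p1 : w ^ β * w ^ (-β) = 1 := by rw [← Real.rpow_add hw0]; simp
  have e : w ^ (4 * a - 2) = w ^ β * w := by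
    rw [← Real.rpow_add_one hw0.ne', hβd]; ring_nf
  rw [profile, e, Real.rpow_one]
  field_simp
  linear_combination (-(4 * a - 2)) * p1

/-- At `a = 3/4` the source is `-x + O(x²)`, so its integral against `x^(-2)` is
`log w + O(1)`. -/
lemma exists_abs_profile_add_log_le :
    ∃ C, ∀ w ∈ Set.Ioc (0 : ℝ) 1, |profile (3 / 4) w + w * Real.log w| ≤ C * w := by
  have hsrc : ∀ x ∈ Set.Ioc (0 : ℝ) 1, |profileSource (3 / 4) x + x| ≤ x ^ 2 := by
    intro x hx
    have h1 : 0 ≤ 1 - x := by linarith [hx.2]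
    have e : (1 - x) ^ (2 * (3 / 4) : ℝ) = (1 - x) * √(1 - x) := by
      rw [Real.sqrt_eq_rpow, show (2 * (3 / 4) : ℝ) = 1 + 1 / 2 by norm_num,
        Real.rpow_add_of_nonneg h1 (by norm_num) (by norm_num), Real.rpow_one]
    have hb1 : 1 + (2 * (3 / 4) : ℝ) * -x ≤ (1 + -x) ^ (2 * (3 / 4) : ℝ) :=
      one_add_mul_self_le_rpow_one_add (by linarith [hx.2]) (by norm_num)
    rw [← sub_eq_add_neg] at hb1
    have hb2 : (1 - x) ^ (2 * (3 / 4) : ℝ) ≤ (1 - x) * (1 - x / 2) := by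
      rw [e]
      have := Real.sqrt_one_add_le (x := -x) (by linarith [hx.2])
      rw [← sub_eq_add_neg] at this
      gcongr
      linarith
    rw [profileSource, if_neg (by norm_num), sourceNumer]
    rw [abs_le]
    constructor <;> nlinarith [hx.1, sq_nonneg x]
  refine ⟨|profileEnd (3 / 4)| + 1, fun w hw => ?_⟩
  have hw0 : 0 < w := hw.1
  have hn0 := zero_notMem_uIcc hw
  have hi := intervalIntegrable_rpow_mul_profileSource (a := 3 / 4) (by norm_num) hw
  have hi2 : IntervalIntegrable (fun x : ℝ => x⁻¹) volume w 1 :=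
    intervalIntegral.intervalIntegrable_inv (fun x hx h => hn0 (h ▸ hx)) continuousOn_id
  have hsum : (∫ x in w..1, x ^ (1 - 4 * (3 / 4) : ℝ) * profileSource (3 / 4) x) - Real.log w =
      ∫ x in w..1, (x ^ (1 - 4 * (3 / 4) : ℝ) * profileSource (3 / 4) x + x⁻¹) := by
    rw [intervalIntegral.integral_add hi hi2, integral_inv hn0, one_div, Real.log_inv]
    ring
  have hb : ‖∫ x in w..1, (x ^ (1 - 4 * (3 / 4) : ℝ) * profileSource (3 / 4) x + x⁻¹)‖ ≤
      ∫ x in w..1, (1 : ℝ) := by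
    refine intervalIntegral.norm_integral_le_of_norm_le hw.2 (Eventually.of_forall ?_)
      intervalIntegrable_const
    intro x hx
    have hx0 : 0 < x := hw0.trans hx.1
    have e : x ^ (1 - 4 * (3 / 4) : ℝ) = (x ^ 2)⁻¹ := by
      rw [show (1 - 4 * (3 / 4) : ℝ) = -((2 : ℕ) : ℝ) by norm_num, Real.rpow_neg hx0.le,
        Real.rpow_natCast]
    have e2 : (x ^ 2)⁻¹ * profileSource (3 / 4) x + x⁻¹ =
        (profileSource (3 / 4) x + x) / x ^ 2 := by field_simp
    rw [e, e2, Real.norm_eq_abs, abs_div, abs_of_pos (by positivity : 0 < x ^ 2),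
      div_le_one (by positivity)]
    exact hsrc x ⟨hx0, hx.2⟩
  rw [intervalIntegral.integral_const, smul_eq_mul, mul_one, Real.norm_eq_abs] at hb
  have e3 : profile (3 / 4) w + w * Real.log w = w * (profileEnd (3 / 4) -
      ((∫ x in w..1, x ^ (1 - 4 * (3 / 4) : ℝ) * profileSource (3 / 4) x) - Real.log w)) := by
    rw [profile, show (4 * (3 / 4) - 2 : ℝ) = 1 by norm_num, Real.rpow_one]
    ring
  rw [e3, hsum, abs_mul, abs_of_pos hw0, mul_comm w]
  gcongr
  refine (abs_sub _ _).trans ?_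
  linarith

lemma intervalIntegrable_betaIntegrand {b c : ℝ} (hb : 0 < b) (hc : 1 ≤ c) :
    IntervalIntegrable (fun x : ℝ => x ^ (b - 1) * (1 - x) ^ (c - 1)) volume 0 1 :=
  (intervalIntegral.intervalIntegrable_rpow' (by linarith)).mul_continuousOn
    (((Real.continuous_rpow_const (by linarith)).comp
      (continuous_const.sub continuous_id)).continuousOn)

lemma tailBeta_zero {b c : ℝ} (hb : 0 < b) (hc : 0 < c) :
    tailBeta b c 0 = ProbabilityTheory.beta b c := by
  rw [ProbabilityTheory.beta_eq_betaIntegralReal b c hb hc, tailBeta, Complex.betaIntegral,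
    ← Complex.ofReal_re (∫ x in (0 : ℝ)..1, x ^ (b - 1) * (1 - x) ^ (c - 1)),
    ← intervalIntegral.integral_ofReal]
  congr 1
  refine intervalIntegral.integral_congr fun x hx => ?_
  rw [Set.uIcc_of_le zero_le_one] at hx
  have h1 : 0 ≤ 1 - x := by linarith [hx.2]
  push_cast [Complex.ofReal_cpow hx.1, Complex.ofReal_cpow h1]
  rfl

lemma tendsto_tailBeta {b c : ℝ} (hb : 0 < b) (hc : 1 ≤ c) :
    Tendsto (tailBeta b c) (𝓝[>] 0) (𝓝 (ProbabilityTheory.beta b c)) := by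
  have hint : IntegrableOn (fun x : ℝ => x ^ (b - 1) * (1 - x) ^ (c - 1)) (Set.uIcc 0 1) := by
    rw [Set.uIcc_of_le zero_le_one, integrableOn_Icc_iff_integrableOn_Ioc]
    exact (intervalIntegrable_iff_integrableOn_Ioc_of_le zero_le_one).1
      (intervalIntegrable_betaIntegrand hb hc)
  have h := intervalIntegral.continuousOn_primitive_interval_left hint 0 (by simp)
  rw [← tailBeta_zero hb (by linarith)]
  refine Tendsto.mono_left h ?_
  rw [Set.uIcc_of_le zero_le_one]
  exact nhdsWithin_le_iff.2 (mem_of_superset (Ioc_mem_nhdsGT one_pos) Set.Ioc_subset_Icc_self)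

/-- For `a < 3/4` the beta tail converges at `w = 0` and the power `w^(4a-2)` dominates the profile.
-/
lemma tendsto_profile_div_of_lt {a : ℝ} (ha : 1 / 2 < a) (ha' : a < 3 / 4) :
    Tendsto (fun w => profile a w / w ^ (4 * a - 2)) (𝓝[>] 0)
      (𝓝 (1 / (8 * a * (a - 1)) *
        (tailCoeff a - 2 * a * ProbabilityTheory.beta (3 - 4 * a) (2 * a)))) := by
  have hpow : ∀ q : ℝ, 0 < q → Tendsto (fun w : ℝ => w ^ q) (𝓝[>] 0) (𝓝 0) := fun q hq => by
    have := (Real.continuousAt_rpow_const (0 : ℝ) q (Or.inr hq.le)).tendsto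
    rw [Real.zero_rpow hq.ne'] at this
    exact this.mono_left nhdsWithin_le_nhds
  have h1 := hpow (3 - 4 * a) (by linarith)
  have h2 := hpow (4 - 4 * a) (by linarith)
  have h3 : Tendsto (fun w : ℝ => (-1 + (1 - w) ^ (2 * a)) / w ^ (4 * a - 2)) (𝓝[>] 0)
      (𝓝 0) := by
    have hs := (hasDerivAt_one_sub_rpow ha 0).tendsto_slope.mono_left (nhdsGT_le_nhdsNE 0)
    have h := hs.mul h1
    rw [mul_zero] at h
    refine h.congr' ?_
    filter_upwards [self_mem_nhdsWithin] with w hw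
    have hw0 : 0 < w := hw
    have e : w ^ (3 - 4 * a) = w / w ^ (4 * a - 2) := by
      rw [eq_div_iff (Real.rpow_pos_of_pos hw0 _).ne', ← Real.rpow_add hw0]
      ring_nf
      exact Real.rpow_one w
    rw [slope_def_field, e]
    simp only [sub_zero, Real.one_rpow]
    field_simp
    ring
  have hT := tendsto_tailBeta (b := 3 - 4 * a) (c := 2 * a) (by linarith) (by linarith)
  have h := ((((h3.add (h1.const_mul (8 * a * (a - 1 / 2)))).sub
    (h2.const_mul (2 * (a * (a - 1 / 2) ^ 2 / (a - 1))))).add_const (tailCoeff a)).sub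
      (hT.const_mul (2 * a))).const_mul (1 / (8 * a * (a - 1)))
  simp only [mul_zero, add_zero, sub_zero, zero_add] at h
  refine h.congr' ?_
  filter_upwards [Ioc_mem_nhdsGT one_pos] with w hw
  have hw0 : 0 < w := hw.1
  have hp := (Real.rpow_pos_of_pos hw0 (4 * a - 2)).ne'
  have e1 : w ^ (3 - 4 * a) = w / w ^ (4 * a - 2) := by
    rw [eq_div_iff hp, ← Real.rpow_add hw0]
    ring_nf
    exact Real.rpow_one w
  have e2 : w ^ (4 - 4 * a) = w ^ 2 / w ^ (4 * a - 2) := by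
    rw [eq_div_iff hp, ← Real.rpow_add hw0]
    ring_nf
    exact Real.rpow_two w
  rw [← closedProfile_eq_profile ha (by linarith) hw0 hw.2, closedProfile, e1, e2]
  field_simp
  ring

/-! ### The constant in the range `1/2 < α < 3/4` -/

lemma lowerBeta_half_le_one {a : ℝ} (ha : 1 / 2 < a) :
    lowerBeta (1 / 2) (2 * a + 1) (2 * a - 2) ≤ 1 := by
  have h : ‖∫ u in (0 : ℝ)..(1 / 2), u ^ (2 * a + 1 - 1) * (1 - u) ^ (2 * a - 2 - 1)‖ ≤
      2 * |1 / 2 - 0| := by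
    refine intervalIntegral.norm_integral_le_of_norm_le_const fun u hu => ?_
    rw [Set.uIoc_of_le (by norm_num)] at hu
    have hu0 : 0 < u := hu.1
    have h1 : (1 / 2 : ℝ) ≤ 1 - u := by linarith [hu.2]
    have h1' : 0 < 1 - u := by linarith
    have b1 : u ^ (2 * a + 1 - 1) ≤ 1 / 2 := by
      calc u ^ (2 * a + 1 - 1) ≤ u ^ (1 : ℝ) :=
            Real.rpow_le_rpow_of_exponent_ge hu0 (by linarith) (by linarith)
        _ = u := Real.rpow_one u
        _ ≤ 1 / 2 := hu.2
    have b2 : (1 - u) ^ (2 * a - 2 - 1) ≤ 4 := by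
      calc (1 - u) ^ (2 * a - 2 - 1) ≤ (1 - u) ^ (-2 : ℝ) :=
            Real.rpow_le_rpow_of_exponent_ge h1' (by linarith) (by linarith)
        _ ≤ (1 / 2 : ℝ) ^ (-2 : ℝ) := Real.rpow_le_rpow_of_nonpos (by norm_num) h1 (by norm_num)
        _ = 4 := by
          rw [Real.rpow_neg (by norm_num), Real.rpow_two]
          norm_num
    rw [norm_mul, Real.norm_of_nonneg (Real.rpow_nonneg hu0.le _),
      Real.norm_of_nonneg (Real.rpow_nonneg h1'.le _)]
    calc _ ≤ (1 / 2 : ℝ) * 4 := mul_le_mul b1 b2 (Real.rpow_nonneg h1'.le _) (by norm_num)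
      _ = 2 := by norm_num
  have h2 := (Real.le_norm_self _).trans h
  rw [lowerBeta]
  refine h2.trans_eq ?_
  norm_num

lemma inv_le_beta {a : ℝ} (ha : 1 / 2 < a) (ha' : a < 3 / 4) :
    1 / (2 * a) ≤ ProbabilityTheory.beta (3 - 4 * a) (2 * a) := by
  have hone : ∫ x in (0 : ℝ)..1, (1 - x) ^ (2 * a - 1) = 1 / (2 * a) := by
    rw [intervalIntegral.integral_comp_sub_left (fun x : ℝ => x ^ (2 * a - 1)) 1, sub_self,
      sub_zero, integral_rpow (Or.inl (by linarith)), sub_add_cancel, Real.one_rpow,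
      Real.zero_rpow (by linarith), sub_zero]
  rw [← tailBeta_zero (by linarith) (by linarith), tailBeta, ← hone]
  refine intervalIntegral.integral_mono_on_of_le_Ioo zero_le_one ?_
    (intervalIntegrable_betaIntegrand (by linarith) (by linarith)) fun x hx => ?_
  · exact (((Real.continuous_rpow_const (by linarith)).comp
      (continuous_const.sub continuous_id)).intervalIntegrable _ _)
  · have h1 : 0 ≤ (1 - x) ^ (2 * a - 1) := Real.rpow_nonneg (by linarith [hx.2]) _
    have h2 : 1 ≤ x ^ (3 - 4 * a - 1) :=
      Real.one_le_rpow_of_pos_of_le_one_of_nonpos hx.1 hx.2.le (by linarith)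
    nlinarith

lemma cConst_eq_of_lt {a : ℝ} (ν : ℝ) (ha : 1 / 2 < a) (ha' : a < 3 / 4) :
    cConst a ν = 1 / (8 * a * (a - 1)) *
      (tailCoeff a - 2 * a * ProbabilityTheory.beta (3 - 4 * a) (2 * a)) *
        xi a ν ^ (4 * a - 2) := by
  have ha0 : a ≠ 0 := by linarith
  have ha1 : a - 1 ≠ 0 := by linarith
  have hbeta : ProbabilityTheory.beta (2 * a) (3 - 4 * a) =
      ProbabilityTheory.beta (3 - 4 * a) (2 * a) := by
    rw [ProbabilityTheory.beta, ProbabilityTheory.beta, mul_comm, add_comm]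
  have h2 : (2 : ℝ) ^ (-4 * a) = 2 / (2 : ℝ) ^ (4 * a + 1) := by
    rw [eq_div_iff (Real.rpow_pos_of_pos two_pos _).ne', ← Real.rpow_add two_pos]
    ring_nf
    exact Real.rpow_one 2
  have h3 := (Real.rpow_pos_of_pos (two_pos (α := ℝ)) (4 * a + 1)).ne'
  rw [cConst, if_neg (by linarith), if_neg (by linarith), tailCoeff, hbeta, h2,
    add_comm 1 (2 * a), show -2 + 2 * a = 2 * a - 2 by ring]
  congr 1
  field_simp
  ring

/-- Only the term with the incomplete beta function is negative, and the one with the complete beta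
function compensates it. -/
lemma cConst_pos_of_lt {a ν : ℝ} (hν : 0 < ν) (ha : 1 / 2 < a) (ha' : a < 3 / 4) :
    0 < cConst a ν := by
  have h1 := lowerBeta_half_le_one ha
  have h2 := inv_le_beta ha ha'
  have hsymm : ProbabilityTheory.beta (2 * a) (3 - 4 * a) =
      ProbabilityTheory.beta (3 - 4 * a) (2 * a) := by
    rw [ProbabilityTheory.beta, ProbabilityTheory.beta, mul_comm, add_comm]
  rw [cConst, if_neg (by linarith), if_neg (by linarith), hsymm]
  refine mul_pos ?_ (Real.rpow_pos_of_pos (xi_pos ha hν) _)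
  have ha0 : 0 < a := by linarith
  have hb : 0 < 1 - a := by linarith
  have t1 : 0 < (3 * a - 1) / ((2 : ℝ) ^ (4 * a + 1) * a * (a - 1) ^ 2) := by
    have : 0 < 3 * a - 1 := by linarith
    have : 0 < (a - 1) ^ 2 := by nlinarith
    positivity
  set L := lowerBeta (1 / 2) (2 * a + 1) (2 * a - 2)
  set B := ProbabilityTheory.beta (3 - 4 * a) (2 * a)
  have t2 : (a - 1 / 2) * L / (2 * (a - 1) * a) - B / (4 * (a - 1)) =
      (2 * a * B - 4 * (a - 1 / 2) * L) / (8 * (1 - a) * a) := by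
    have : a - 1 ≠ 0 := by linarith
    field_simp
    ring
  have t3 : 1 ≤ 2 * a * B := by
    rw [div_le_iff₀ (by positivity)] at h2
    linarith
  have t4 : 4 * (a - 1 / 2) * L ≤ 1 := by
    have : 4 * (a - 1 / 2) * L ≤ 4 * (a - 1 / 2) * 1 := by
      have : 0 < a - 1 / 2 := by linarith
      gcongr
    linarith
  have t5 : 0 ≤ (2 * a * B - 4 * (a - 1 / 2) * L) / (8 * (1 - a) * a) :=
    div_nonneg (by linarith) (by positivity)
  rw [add_sub_assoc, t2]
  linarith

lemma isEquivalent_of_tendsto_mul_rpow {u : ℕ → ℝ} {c p : ℝ} (hc : c ≠ 0)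
    (h : Tendsto (fun k : ℕ => u k * (k : ℝ) ^ p) atTop (𝓝 c)) :
    u ~[atTop] fun k : ℕ => c * (k : ℝ) ^ (-p) := by
  refine isEquivalent_of_tendsto_one ?_
  have h' := h.div_const c
  rw [div_self hc] at h'
  refine h'.congr' ?_
  filter_upwards [eventually_gt_atTop 0] with k hk
  have hk0 : (0 : ℝ) < k := by exact_mod_cast hk
  have := Real.rpow_pos_of_pos hk0 p
  simp only [Pi.div_apply]
  rw [Real.rpow_neg hk0.le]
  field_simp

end KPKVB

end

open KPKVB in
theorem proposition1p4 (α ν : ℝ) (hα : 1 / 2 < α) (hν : 0 < ν) :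
    -- the limit that defines `γ(k)` for `α = 1` exists
    (∀ k : ℕ, 2 ≤ k →
      Tendsto (fun a => KPKVB.gammaClosed a ν k) (𝓝[≠] (1 : ℝ)) (𝓝 (KPKVB.gammaFun 1 ν k))) ∧
    (3 / 4 < α →
      (fun k : ℕ => KPKVB.gammaFun α ν k) ~[atTop]
        (fun k : ℕ => KPKVB.cConst α ν * (k : ℝ) ^ (-1 : ℝ))) ∧
    (α = 3 / 4 →
      (fun k : ℕ => KPKVB.gammaFun α ν k) ~[atTop]
        (fun k : ℕ => KPKVB.cConst α ν * (Real.log k / k))) ∧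
    (α < 3 / 4 →
      (fun k : ℕ => KPKVB.gammaFun α ν k) ~[atTop]
        (fun k : ℕ => KPKVB.cConst α ν * (k : ℝ) ^ (2 - 4 * α))) := by
  have hx := xi_pos hα hν
  have hcont : ContinuousOn (profile α) (Set.Ioc 0 1) :=
    (continuousOn_profile hα).mono fun _ hw => hw.1
  obtain ⟨M, hM⟩ := exists_abs_profile_le hα
  have hfun : (fun k : ℕ => gammaFun α ν k) = fun k => profileMean α (xi α ν) k (profile α) :=
    funext fun k => gammaFun_eq_profileMean hα hν k
  refine ⟨fun k _ => ?_, fun h => ?_, fun h => ?_, fun h => ?_⟩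
  · rw [gammaFun_eq_profileMean (by norm_num) hν]
    exact tendsto_gammaClosed hν k
  · have hlim := tendsto_profileMean_mul_rpow hx α hcont hM zero_le_one
      (tendsto_profile_div_of_gt h)
    have hc : (4 * α - 2) / (4 * α - 3) * xi α ν ^ (1 : ℝ) = cConst α ν := by
      have h1 : 2 * α - 1 ≠ 0 := by linarith
      have h2 : 4 * α - 3 ≠ 0 := by linarith
      have := Real.pi_pos.ne'
      rw [cConst, if_pos h, Real.rpow_one, xi, show 4 * α - 2 = 2 * (2 * α - 1) by ring]
      field_simp
      ring
    rw [hc] at hlim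
    rw [hfun]
    refine isEquivalent_of_tendsto_mul_rpow ?_ hlim
    rw [← hc]
    have h1 : 0 < 4 * α - 2 := by linarith
    have h2 : 0 < 4 * α - 3 := by linarith
    positivity
  · subst h
    obtain ⟨C, hC⟩ := exists_abs_profile_add_log_le
    have hlim := tendsto_profileMean_log hx (3 / 4) hcont hM hC
    have hc : cConst (3 / 4) ν = xi (3 / 4) ν := by
      have := Real.pi_pos.ne'
      rw [cConst, if_neg (lt_irrefl _), if_pos rfl, xi]
      field_simp
      norm_num
    rw [hfun, hc]
    refine isEquivalent_of_tendsto_one ?_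
    have h' := hlim.div_const (xi (3 / 4) ν)
    rw [div_self hx.ne'] at h'
    refine h'.congr fun k => ?_
    simp only [Pi.div_apply]
    simp only [div_eq_mul_inv, mul_inv, inv_inv]
    ring
  · have hlim := tendsto_profileMean_mul_rpow hx α hcont hM (by linarith)
      (tendsto_profile_div_of_lt hα h)
    rw [← cConst_eq_of_lt ν hα h] at hlim
    rw [hfun, show 2 - 4 * α = -(4 * α - 2) by ring]
    exact isEquivalent_of_tendsto_mul_rpow (cConst_pos_of_lt hν hα h).ne' hlim
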